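/- **Setting.** Let $\mathcal M=(\mathcal U,\mathcal I)$ be a matroid with $n=|\mathcal U|$ and rank $r\ge 2$. Let $f:2^{\mathcal U}\to\mathbb R$ be normalized ($f(\emptyset)=0$), monotone and submodular, with curvature $c\in(0,1]$, i.e. $f(A+x)-f(A)\ge(1-c)f(\{x\})$ whenever $x\notin A$. Let $\alpha>0$. Put $\rho(c)=(1-e^{-c})/c$ and $H_k=\sum_{t=1}^k 1/t$. **Estimating the potential.** For integers $0\le b\le a$ let $m_{a,b}=\int_0^1\frac{ce^{cp}}{e^c-1}p^b(1-p)^{a-b}\,dp$, and let $m_{a,b}=0$ if $a$ or $b$ is negative. For nonempty $A$ let $\tau(A)=\sum_{B\subseteq A}m_{|A|-1,|B|-1}$, and let $\nu_A$ be the distribution on subsets of $A$ with $\nu_A(B)=m_{|A|-1,|B|-1}/\tau(A)$. For a set function $h$, each evaluation of $\tilde g(A)$ draws $N$ fresh independent samples $B_1,\dots,B_N\sim\nu_A$ and returns $\tau(A)\frac1N\sum_{i=1}^N h(B_i)$. **Algorithm 2** on $(\mathcal M',h)$, where $\mathcal M'$ has rank $r'$ and $n'$ elements, with parameters $c,\varepsilon,\alpha$.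 Set $$\varepsilon_2=\frac{\varepsilon}{4r'H_{r'}},\quad I=\Big\lceil\Big(\tfrac{1+\varepsilon_2}{1-\varepsilon_2}(2+3r'\varepsilon_2)-1\Big)\varepsilon_2^{-1}\Big\rceil,\quad N=\Big\lceil\tfrac12\Big(\tfrac{ce^c}{e^c-1}\cdot\tfrac{H_{n'}}{\varepsilon_2}\Big)^2\ln\big((I+1)r'n'^{\,1+\alpha}\big)\Big\rceil .$$ Run the standard greedy algorithm on $(\mathcal M',\tilde g)$ to obtain $S$, and set $v\leftarrow\tilde g(S)$. Then repeat at most $I$ times: go through the exchanges $S'=S-e+x$ ($e\in S$, $x\notin S$), and for each independent $S'$ sample $v'\leftarrow\tilde g(S')$. At the first $S'$ with $v'>(1+\varepsilon_2)v$, replace $(S,v)$ by $(S',v')$ and start the next iteration. If there is no such $S'$, return $S$. If nothing was returned after $I$ iterations, report an error. **Partial enumeration algorithm.** For every $x\in\mathcal U$ with $\{x\}\in\mathcal I$, run Algorithm 2 on $(\mathcal M/x,f/x)$ with $\varepsilon=(1-\rho(c))/r$. Here $\mathcal M/x$ is the contracted matroid on $\mathcal U-x$ and $(f/x)(A)=f(A+x)$.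 Let $S_x$ be the set returned, if any. Return the set $S_x+x$ that maximizes $f(S_x+x)$. **Theorem 7.2.** There are absolute constants $C>0$ and $k\in\mathbb N$ such that, for all such $\mathcal M,f,c,\alpha$ and for every order in which elements and exchanges are scanned according to a linear order on $\mathcal U$: 1. In every execution, the running time of the partial enumeration algorithm is at most $$C\,\frac{r^7n^2\max(\alpha,1)}{(1-\rho(c))^3}\,\Big(\ln\frac{n}{1-\rho(c)}\Big)^{k}.$$ Hence it is $\tilde O(r^7n^2\alpha)$ for each fixed $c$ and all $\alpha\ge1$. Running time counts the calls to the value oracle for $f$ and to the independence oracle of $\mathcal M$, the random draws from the distributions $\nu_A$, and the arithmetic operations and comparisons on sampled values, each at unit cost. The parameters $\varepsilon_2,I,N,\tau$ are taken as given. 2. With probability at least $1-C\,n^{-\alpha}$, the algorithm returns a set $S\in\mathcal I$ with $f(S)\ge\rho(c)\,f(O)$ for every $O\in\mathcal I$. -/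

import Mathlib

/-! ## Set functions -/

section SetFunctions

variable {U : Type} [DecidableEq U]

def SetFun.Normalized (f : Finset U → ℝ) : Prop := f ∅ = 0

def SetFun.Submodular (f : Finset U → ℝ) : Prop :=
  ∀ A B : Finset U, f (A ∪ B) + f (A ∩ B) ≤ f A + f B

/-- `f` has curvature `c` if `f (A + x) - f A ≥ (1 - c) f {x}` whenever `x ∉ A`. -/
def SetFun.HasCurvature (f : Finset U → ℝ) (c : ℝ) : Prop :=
  ∀ (A : Finset U) (x : U), x ∉ A → (1 - c) * f {x} ≤ f (insert x A) - f A

/-- The contracted set function `f / x`, which is `A ↦ f (A + x)`. -/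
def SetFun.contract (f : Finset U → ℝ) (x : U) : Finset U → ℝ := fun A => f (insert x A)

end SetFunctions

/-- `ρ(c) = (1 - e^{-c}) / c`. -/
noncomputable def rho (c : ℝ) : ℝ := (1 - Real.exp (-c)) / c

/-- The rank of a matroid, as a natural number (used for finite matroids only). -/
noncomputable def matroidRank {U : Type} (M : Matroid U) : ℕ := M.eRank.toNat

/-- The ground set of a matroid on a finite type, as a `Finset`. -/
noncomputable def matroidGround {U : Type} [Fintype U] (M : Matroid U) : Finset U :=
  (Set.toFinite M.E).toFinset

/-! ## The coefficients of the potential function and the sampling distribution -/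

/-- `m_{a,b} = ∫₀¹ c e^{cp} / (e^c - 1) · p^b (1 - p)^{a - b} dp` for `0 ≤ b ≤ a`, and `m_{a,b} = 0`
if `a` or `b` is negative. -/
noncomputable def mCoeff (c : ℝ) (a b : ℤ) : ℝ :=
  if a < 0 ∨ b < 0 then 0
  else ∫ p in (0 : ℝ)..1,
    c * Real.exp (c * p) / (Real.exp c - 1) * (p ^ b.toNat * (1 - p) ^ (a - b).toNat)

/-- The coefficient of `f B` in the potential `g A = ∑_{B ⊆ A} m_{|A|-1,|B|-1} f B`. -/
noncomputable def gWeight {U : Type} (c : ℝ) (A B : Finset U) : ℝ :=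
  mCoeff c ((A.card : ℤ) - 1) ((B.card : ℤ) - 1)

/-- `τ(A) = ∑_{B ⊆ A} m_{|A|-1,|B|-1}`. -/
noncomputable def tau {U : Type} (c : ℝ) (A : Finset U) : ℝ :=
  ∑ B ∈ A.powerset, gWeight c A B

theorem mCoeff_nonneg {c : ℝ} (hc : 0 < c) (a b : ℤ) : 0 ≤ mCoeff c a b := by
  unfold mCoeff
  split_ifs
  · exact le_rfl
  · apply intervalIntegral.integral_nonneg (by norm_num)
    intro p hp
    have h1 : 0 < Real.exp c - 1 := by linarith [Real.add_one_lt_exp hc.ne']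
    have h2 : 0 ≤ 1 - p := by linarith [hp.2]
    have h3 : 0 ≤ p := hp.1
    positivity

theorem mCoeff_diag_pos {c : ℝ} (hc : 0 < c) (k : ℕ) : 0 < mCoeff c k k := by
  unfold mCoeff
  have hk : ¬ ((k : ℤ) < 0 ∨ (k : ℤ) < 0) := by omega
  rw [if_neg hk]
  have h1 : 0 < Real.exp c - 1 := by linarith [Real.add_one_lt_exp hc.ne']
  apply intervalIntegral.intervalIntegral_pos_of_pos_on
  · apply Continuous.intervalIntegrable
    fun_prop
  · intro p hp
    have h3 : 0 < p := hp.1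
    have : ((k : ℤ) - k).toNat = 0 := by simp
    rw [this, pow_zero]
    positivity
  · norm_num

theorem tau_pos {U : Type} {c : ℝ} (hc : 0 < c) {A : Finset U} (hA : A.Nonempty) :
    0 < tau c A := by
  refine Finset.sum_pos' (fun B _ => mCoeff_nonneg hc _ _) ⟨A, Finset.mem_powerset_self A, ?_⟩
  have h1 : 1 ≤ A.card := hA.card_pos
  have h2 : ((A.card : ℤ) - 1) = ((A.card - 1 : ℕ) : ℤ) := by omega
  unfold gWeight
  rw [h2]
  exact mCoeff_diag_pos hc _

open Classical in
theorem nu_sum_eq_one {U : Type} {c : ℝ} {A : Finset U} (h : 0 < c ∧ A.Nonempty) :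
    ∑ B ∈ A.powerset,
      (if B ⊆ A then ENNReal.ofReal (gWeight c A B / tau c A) else 0) = 1 := by
  have hτ := tau_pos h.1 h.2
  rw [Finset.sum_congr rfl (g := fun B => ENNReal.ofReal (gWeight c A B / tau c A))
      (fun B hB => if_pos (Finset.mem_powerset.mp hB)),
    ← ENNReal.ofReal_sum_of_nonneg
      (f := fun B => gWeight c A B / tau c A)
      (fun B _ => div_nonneg (mCoeff_nonneg h.1 _ _) hτ.le),
    ← Finset.sum_div]
  have : ∑ B ∈ A.powerset, gWeight c A B = tau c A := rfl
  rw [this, div_self hτ.ne', ENNReal.ofReal_one]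

open Classical in
/-- The distribution `ν_A` on the subsets of `A`, with `ν_A(B) = m_{|A|-1,|B|-1} / τ(A)`, for
nonempty `A` and `c > 0`. (Otherwise `ν_A` is not defined; we then put all mass on `∅`.) -/
noncomputable def nu {U : Type} (c : ℝ) (A : Finset U) : PMF (Finset U) :=
  if h : 0 < c ∧ A.Nonempty then
    PMF.ofFinset
      (fun B => if B ⊆ A then ENNReal.ofReal (gWeight c A B / tau c A) else 0)
      A.powerset (nu_sum_eq_one h)
      (fun _ hB => if_neg (fun hs => hB (Finset.mem_powerset.mpr hs)))
  else PMF.pure ∅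

/-! ## Randomized programs with a step counter -/

/-- A randomized program: the joint law of its output and of the number of steps it has made. -/
def Prog (α : Type) : Type := PMF (α × ℕ)

/-- The joint law of the output and the number of steps. -/
def Prog.law {α : Type} (p : Prog α) : PMF (α × ℕ) := p

noncomputable instance : Monad Prog where
  pure a := PMF.pure (a, 0)
  bind p q := PMF.bind p fun x => PMF.bind (q x.1) fun y => PMF.pure (y.1, x.2 + y.2)

/-- One elementary step: an arithmetic operation or a comparison. -/
noncomputable def step : Prog Unit := PMF.pure ((), 1)

section Algorithm

variable {U : Type}

/-- One call to the value oracle for `f`. -/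
noncomputable def queryValue (f : Finset U → ℝ) (A : Finset U) : Prog ℝ := PMF.pure (f A, 1)

open Classical in
/-- One call to the membership oracle for the independent sets of `M`. -/
noncomputable def queryIndep (M : Matroid U) (A : Finset U) : Prog Bool :=
  PMF.pure (decide (M.Indep (A : Set U)), 1)

/-- Draw one fresh random set from `ν_A`. -/
noncomputable def drawSet (c : ℝ) (A : Finset U) : Prog (Finset U) :=
  PMF.bind (nu c A) fun B => PMF.pure (B, 1)

/-- The sum of `f` over `N` fresh independent samples from `ν_A`. -/
noncomputable def sampleSum (f : Finset U → ℝ) (c : ℝ) (A : Finset U) : ℕ → Prog ℝ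
  | 0 => pure 0
  | N + 1 => do
    let B ← drawSet c A
    let y ← queryValue f B
    let s ← sampleSum f c A N
    step
    pure (y + s)

/-- A fresh estimate of the potential, `τ(A) · (1/N) ∑_{i=1}^N f(B_i)`. -/
noncomputable def estimate (f : Finset U → ℝ) (c : ℝ) (N : ℕ) (A : Finset U) : Prog ℝ := do
  let s ← sampleSum f c A N
  step
  pure (tau c A * (s / N))

variable [LinearOrder U]

/-- Scan a list of candidates `y` for the independent extension `S + y` of largest estimated
potential; `best` is the best candidate found so far, together with its estimate. -/
noncomputable def bestExtension (M : Matroid U) (f : Finset U → ℝ) (c : ℝ) (N : ℕ)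
    (S : Finset U) : List U → Option (U × ℝ) → Prog (Option (U × ℝ))
  | [], best => pure best
  | y :: ys, best => do
    let ok ← queryIndep M (insert y S)
    if ok then
      let w ← estimate f c N (insert y S)
      step
      match best with
      | none => bestExtension M f c N S ys (some (y, w))
      | some (z, u) =>
        if u < w then bestExtension M f c N S ys (some (y, w))
        else bestExtension M f c N S ys (some (z, u))
    else bestExtension M f c N S ys best

/-- The remaining rounds (at most `k`) of the standard greedy algorithm on the sampled potential,
from the current set `S`. -/
noncomputable def greedyPhase (M : Matroid U) (f : Finset U → ℝ) (c : ℝ) (N : ℕ)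
    (E : Finset U) : ℕ → Finset U → Prog (Finset U)
  | 0, S => pure S
  | k + 1, S => do
    let best ← bestExtension M f c N S (E \ S).sort none
    match best with
    | none => pure S
    | some (y, _) => greedyPhase M f c N E k (insert y S)

/-- Scan a list of exchanges `(e, x)` and return the first `S' = S - e + x` that is independent and
whose sampled potential exceeds `(1 + ε₂) v`, together with the sampled value. -/
noncomputable def findExchange (M : Matroid U) (f : Finset U → ℝ) (c : ℝ) (N : ℕ) (ε₂ : ℝ)
    (S : Finset U) (v : ℝ) : List (U × U) → Prog (Option (Finset U × ℝ))
  | [] => pure none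
  | (e, x) :: rest => do
    let ok ← queryIndep M (insert x (S.erase e))
    if ok then
      let v' ← estimate f c N (insert x (S.erase e))
      step
      if (1 + ε₂) * v < v' then pure (some (insert x (S.erase e), v'))
      else findExchange M f c N ε₂ S v rest
    else findExchange M f c N ε₂ S v rest

/-- The local search loop with at most `k` remaining iterations, from the current solution `S` with
stored sampled value `v`. The output `none` is the outcome `Error`. -/
noncomputable def localSearch (M : Matroid U) (f : Finset U → ℝ) (c : ℝ) (N : ℕ) (ε₂ : ℝ)
    (E : Finset U) : ℕ → Finset U → ℝ → Prog (Option (Finset U))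
  | 0, _, _ => pure none
  | k + 1, S, v => do
    let ex ← findExchange M f c N ε₂ S v (S.sort.product (E \ S).sort)
    match ex with
    | none => pure (some S)
    | some (S', v') => localSearch M f c N ε₂ E k S' v'

/-- `ε₂ = ε / (4 r H_r)`. -/
noncomputable def epsTwo (r : ℕ) (ε : ℝ) : ℝ := ε / (4 * r * (harmonic r : ℝ))

/-- The number of local search iterations,
`I = (((1 + ε₂) / (1 - ε₂)) (2 + 3 r ε₂) - 1) ε₂⁻¹`, rounded up. -/
noncomputable def numIter (r : ℕ) (ε₂ : ℝ) : ℕ :=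
  ⌈((1 + ε₂) / (1 - ε₂) * (2 + 3 * r * ε₂) - 1) * ε₂⁻¹⌉₊

/-- The number of samples,
`N = (1/2) ((c e^c / (e^c - 1)) (H_n / ε₂))² ln ((I + 1) r n^{1 + α})`, rounded up. -/
noncomputable def numSamples (r n : ℕ) (c ε₂ α : ℝ) (I : ℕ) : ℕ :=
  ⌈1 / 2 * (c * Real.exp c / (Real.exp c - 1) * ((harmonic n : ℝ) / ε₂)) ^ 2 *
    Real.log (((I : ℝ) + 1) * r * (n : ℝ) ^ (1 + α))⌉₊

variable [Fintype U]

/-- The randomized non-oblivious local search algorithm on the instance `(M, f)`, with curvature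
bound `c` and parameters `ε`, `α`; here `r` and `n` are the rank and the size of the ground set of
the matroid `M` on which it is run. -/
noncomputable def nonObliviousSearch (M : Matroid U) (f : Finset U → ℝ) (c ε α : ℝ) :
    Prog (Option (Finset U)) :=
  let E := matroidGround M
  let r := matroidRank M
  let ε₂ := epsTwo r ε
  let I := numIter r ε₂
  let N := numSamples r E.card c ε₂ α I
  do
    let S ← greedyPhase M f c N E r ∅
    let v ← estimate f c N S
    localSearch M f c N ε₂ E I S v

/-- For each `x` in the list with `{x}` independent, run the search on `(M / x, f / x)`; if it
returns `S_x`, compare `f (S_x + x)` with the best value so far. -/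
noncomputable def enumLoop (M : Matroid U) (f : Finset U → ℝ) (c ε α : ℝ) :
    List U → Option (Finset U × ℝ) → Prog (Option (Finset U × ℝ))
  | [], best => pure best
  | x :: xs, best => do
    let ok ← queryIndep M {x}
    if ok then
      let out ← nonObliviousSearch (M.contract {x}) (SetFun.contract f x) c ε α
      match out with
      | none => enumLoop M f c ε α xs best
      | some S =>
        let w ← queryValue f (insert x S)
        step
        match best with
        | none => enumLoop M f c ε α xs (some (insert x S, w))
        | some (T, u) =>
          if u < w then enumLoop M f c ε α xs (some (insert x S, w))
          else enumLoop M f c ε α xs (some (T, u))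
    else enumLoop M f c ε α xs best

/-- The partial enumeration algorithm: run the search on all contractions `(M / x, f / x)` with
`ε = (1 - ρ(c)) / r`, where `r` is the rank of `M`, and return the best of the sets `S_x + x`.
The output is `none` if no run returned a set. -/
noncomputable def partialEnumeration (M : Matroid U) (f : Finset U → ℝ) (c α : ℝ) :
    Prog (Option (Finset U)) := do
  let best ← enumLoop M f c ((1 - rho c) / matroidRank M) α (matroidGround M).sort none
  pure (best.map Prod.fst)

end Algorithm

/-- `out` is a set `S`, independent in `M`, with `f S ≥ a · f O` for every independent `O`. -/
def IsApproxSolution {U : Type} (M : Matroid U) (f : Finset U → ℝ) (a : ℝ)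
    (out : Option (Finset U)) : Prop :=
  ∃ S : Finset U, out = some S ∧ M.Indep (S : Set U) ∧
    ∀ O : Finset U, M.Indep (O : Set U) → a * f O ≤ f S

/-! Let `B` contain each element of `A` independently with probability `p`. Adding a new `x` to `A`
raises the potential `g` by the `density`-weighted integral over `p` of the expected marginal of `x`
at `B` (`potential_insert`). Hence `g` is monotone with diminishing returns, dominates `f` on
nonempty sets, and satisfies `g A ≤ τ(A) f A` with `τ(A) ≤ density c 1 * H_{|A|}`.

Approximation. Between bases `S` and `O`, Hall's theorem gives a bijection all of whose single
exchanges are independent (`exists_exchange_bijection`). Sum the losses of `g` over these exchanges.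
The removals contribute the derivative of `F(p) = E f(B)`, `B ⊆ S` random; by curvature, the
insertions contribute at least `f O - c F(p)` (`exchange_marginals`). Since the density satisfies
`w' = c w`, the integrand `w (F' + c F)` is the derivative of `w F`, so the total loss is at most
`density c 1 * f S - f O` (`potential_exchange_sum_le`). As `density c 1 = 1 / ρ(c)`, an approximate
local optimum of `g` has ratio `ρ(c)` up to an error governed by `ε`. Contracting a most valuable
element `x` of an optimal base `O` removes this error: `f {x}` is obtained without the factor
`ρ(c)`, and the gain `(1 - ρ(c)) f {x} ≥ (1 - ρ(c)) f O / r` pays for `ε = (1 - ρ(c)) / r`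
(`fails_best_run`).

Sampling. The samples for `g A` lie in `[0, f A]` and `f A ≤ g A`, so Hoeffding's inequality gives
relative accuracy `ε₂` (`fails_estimate`). Greedy starts within a factor `2 + 3 r ε₂` of every base
and each exchange multiplies the stored value by more than `1 + ε₂`, so `I` iterations suffice. A
union bound over all estimates of one run gives failure probability at most `2 n^{-α}`. Only the run
for `x` has to succeed: every other run returns an independent set if anything, and the loop keeps
the maximum (`fails_enumLoop`).

Running time. Up to logarithms `I` is `r² / (1 - ρ)` and `N` is `r⁴ max(α, 1) / (1 - ρ)²`; there are
`n` runs, each with about `I r n` estimates of cost `3N`. -/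

open scoped ENNReal

/-! ## Reasoning about randomized programs -/

namespace Prog

variable {α β : Type}

/-- The expectation of a nonnegative function of the output. -/
noncomputable def ev (p : Prog α) (k : α → ℝ≥0∞) : ℝ≥0∞ := ∑' ω, p.law ω * k ω.1

theorem law_pure (a : α) : (pure a : Prog α).law = PMF.pure (a, 0) := rfl

theorem law_bind (p : Prog α) (q : α → Prog β) :
    (p >>= q).law = PMF.bind p.law fun x => PMF.bind (q x.1).law fun y =>
      PMF.pure (y.1, x.2 + y.2) := rfl

theorem tsum_pmf_pure {γ : Type} (a : γ) (k : γ → ℝ≥0∞) : ∑' ω, PMF.pure a ω * k ω = k a := by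
  rw [tsum_eq_single a]
  · simp
  · intro b hb
    simp [PMF.pure_apply, hb]

theorem tsum_pmf_bind {γ δ : Type} (p : PMF γ) (q : γ → PMF δ) (k : δ → ℝ≥0∞) :
    ∑' ω, (p.bind q) ω * k ω = ∑' x, p x * ∑' y, q x y * k y := by
  simp_rw [PMF.bind_apply, ← ENNReal.tsum_mul_right, ← ENNReal.tsum_mul_left]
  rw [ENNReal.tsum_comm]
  simp_rw [mul_assoc]

theorem ev_of_law_pure {p : Prog α} {a : α} {t : ℕ} (h : p.law = PMF.pure (a, t))
    (k : α → ℝ≥0∞) : p.ev k = k a := by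
  unfold ev
  rw [h]
  exact tsum_pmf_pure (a, t) fun ω => k ω.1

theorem ev_pure (a : α) (k : α → ℝ≥0∞) : ev (pure a) k = k a :=
  ev_of_law_pure (law_pure a) k

theorem ev_bind (p : Prog α) (q : α → Prog β) (k : β → ℝ≥0∞) :
    ev (p >>= q) k = ev p fun x => ev (q x) k := by
  unfold ev
  rw [law_bind]
  rw [tsum_pmf_bind _ _ fun ω : β × ℕ => k ω.1]
  refine tsum_congr fun x => ?_
  rw [tsum_pmf_bind _ _ fun ω : β × ℕ => k ω.1]
  simp_rw [tsum_pmf_pure _ fun ω : β × ℕ => k ω.1]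

theorem ev_mono (p : Prog α) {k l : α → ℝ≥0∞} (h : ∀ x, k x ≤ l x) : p.ev k ≤ p.ev l :=
  ENNReal.tsum_le_tsum fun _ => mul_le_mul_right (h _) _

theorem ev_add (p : Prog α) (k l : α → ℝ≥0∞) :
    p.ev (fun x => k x + l x) = p.ev k + p.ev l := by
  unfold ev
  simp_rw [mul_add]
  exact ENNReal.tsum_add

theorem ev_const (p : Prog α) (a : ℝ≥0∞) : p.ev (fun _ => a) = a := by
  unfold ev
  rw [ENNReal.tsum_mul_right, PMF.tsum_coe, one_mul]

theorem ev_mul_left (p : Prog α) (a : ℝ≥0∞) (k : α → ℝ≥0∞) :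
    p.ev (fun x => a * k x) = a * p.ev k := by
  unfold ev
  rw [← ENNReal.tsum_mul_left]
  simp_rw [mul_left_comm]

/-- `p` violates the postcondition `Q` with probability at most `δ`. -/
def Fails (p : Prog α) (Q : α → Prop) (δ : ℝ≥0∞) : Prop :=
  p.ev (Set.indicator {x | ¬ Q x} 1) ≤ δ

/-- The union bound. The second bound is conditional on the outcome of `p`, so the choice of the
later samples may depend on the earlier ones. -/
theorem Fails.bind {p : Prog α} {q : α → Prog β} {Q : α → Prop} {R : β → Prop} {δ₁ δ₂ : ℝ≥0∞}
    (hp : p.Fails Q δ₁) (hq : ∀ x, Q x → (q x).Fails R δ₂) : (p >>= q).Fails R (δ₁ + δ₂) := by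
  unfold Fails at *
  rw [ev_bind]
  calc _ ≤ p.ev (fun x => Set.indicator {x | ¬ Q x} 1 x + δ₂) := by
        refine ev_mono _ fun x => ?_
        by_cases hx : Q x
        · exact (hq x hx).trans le_add_self
        · have h1 : Set.indicator {x | ¬ Q x} (1 : α → ℝ≥0∞) x = 1 := by simp [hx]
          rw [h1]
          refine le_trans ?_ le_self_add
          calc _ ≤ (q x).ev fun _ => 1 := by
                refine ev_mono _ fun y => ?_
                exact Set.indicator_le_self' (by simp) y
            _ = 1 := ev_const _ _
    _ = _ := by rw [ev_add, ev_const]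
    _ ≤ _ := by gcongr

theorem Fails.mono {p : Prog α} {Q R : α → Prop} {δ δ' : ℝ≥0∞}
    (hp : p.Fails Q δ) (h : ∀ x, Q x → R x) (hδ : δ ≤ δ') : p.Fails R δ' := by
  refine le_trans (ev_mono _ fun x => ?_) (hp.trans hδ)
  have hsub : {x | ¬ R x} ⊆ {x | ¬ Q x} := fun y hy hQ => hy (h y hQ)
  exact Set.indicator_le_indicator_of_subset hsub (by simp) x

theorem fails_of_law_pure {p : Prog α} {a : α} {t : ℕ} (h : p.law = PMF.pure (a, t))
    {Q : α → Prop} (hQ : Q a) (δ : ℝ≥0∞) : p.Fails Q δ := by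
  unfold Fails
  rw [ev_of_law_pure h]
  simp [hQ]

theorem fails_pure {a : α} {Q : α → Prop} (hQ : Q a) (δ : ℝ≥0∞) :
    (pure a : Prog α).Fails Q δ := fails_of_law_pure (law_pure a) hQ δ

/-- A deterministic step does not affect the failure probability. -/
theorem Fails.det_bind {p : Prog α} {q : α → Prog β} {a : α} {t : ℕ}
    (h : p.law = PMF.pure (a, t)) {R : β → Prop} {δ : ℝ≥0∞} (hq : (q a).Fails R δ) :
    (p >>= q).Fails R δ := by
  have := Fails.bind (δ₁ := 0) (fails_of_law_pure (Q := fun x => x = a) h rfl 0)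
    (fun x hx => by rw [hx]; exact hq)
  rwa [zero_add] at this

theorem toOuterMeasure_of_fails {p : Prog α} {Q : α → Prop} {δ : ℝ} (hδ : 0 ≤ δ)
    (h : p.Fails Q (ENNReal.ofReal δ)) :
    1 - δ ≤ (p.law.toOuterMeasure {ω | Q ω.1}).toReal := by
  have h1 : p.law.toOuterMeasure {ω | Q ω.1} = p.ev (Set.indicator {x | Q x} 1) := by
    rw [PMF.toOuterMeasure_apply]
    refine tsum_congr fun ω => ?_
    by_cases hω : Q ω.1 <;> simp [hω]
  have h2 : p.ev (Set.indicator {x | Q x} 1) + p.ev (Set.indicator {x | ¬ Q x} 1) = 1 := by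
    rw [← ev_add, ← ev_const p 1]
    congr 1
    funext x
    by_cases hx : Q x <;> simp [hx]
  rw [h1]
  have h3 : p.ev (Set.indicator {x | Q x} 1) ≠ ∞ := by
    intro h
    rw [h] at h2
    simp at h2
  have h4 : (1 : ℝ≥0∞) ≤ p.ev (Set.indicator {x | Q x} 1) + ENNReal.ofReal δ := by
    rw [← h2]
    gcongr
    exact h
  have h5 := ENNReal.toReal_mono (ENNReal.add_ne_top.2 ⟨h3, ENNReal.ofReal_ne_top⟩) h4
  rw [ENNReal.toReal_add h3 ENNReal.ofReal_ne_top, ENNReal.toReal_ofReal hδ,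
    ENNReal.toReal_one] at h5
  linarith

/-- In every execution `p` makes at most `T` steps and its output satisfies `Q`. -/
def Within (p : Prog α) (T : ℕ) (Q : α → Prop) : Prop :=
  ∀ ω ∈ p.law.support, ω.2 ≤ T ∧ Q ω.1

theorem within_of_law_pure {p : Prog α} {a : α} {t T : ℕ} (h : p.law = PMF.pure (a, t))
    (ht : t ≤ T) {Q : α → Prop} (hQ : Q a) : p.Within T Q := by
  intro ω hω
  rw [h, PMF.support_pure] at hω
  rw [Set.mem_singleton_iff.1 hω]
  exact ⟨ht, hQ⟩

theorem within_pure {a : α} {T : ℕ} {Q : α → Prop} (hQ : Q a) :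
    (pure a : Prog α).Within T Q := within_of_law_pure (law_pure a) (Nat.zero_le _) hQ

theorem Within.bind {p : Prog α} {q : α → Prog β} {Q : α → Prop} {R : β → Prop} {S T : ℕ}
    (hp : p.Within S Q) (hq : ∀ x, Q x → (q x).Within T R) : (p >>= q).Within (S + T) R := by
  intro ω hω
  rw [law_bind] at hω
  simp only [PMF.mem_support_bind_iff, PMF.support_pure, Set.mem_singleton_iff] at hω
  obtain ⟨x, hx, y, hy, rfl⟩ := hω
  have h1 := hp x hx
  have h2 := hq x.1 h1.2 y hy
  exact ⟨add_le_add h1.1 h2.1, h2.2⟩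

theorem Within.mono {p : Prog α} {Q R : α → Prop} {S T : ℕ} (hp : p.Within S Q)
    (hST : S ≤ T) (h : ∀ x, Q x → R x) : p.Within T R :=
  fun ω hω => ⟨(hp ω hω).1.trans hST, h _ (hp ω hω).2⟩

theorem Within.det_bind {p : Prog α} {q : α → Prog β} {a : α} {s T : ℕ}
    (h : p.law = PMF.pure (a, s)) {R : β → Prop} (hq : (q a).Within T R) :
    (p >>= q).Within (s + T) R :=
  Within.bind (within_of_law_pure (Q := fun x => x = a) h le_rfl rfl)
    (fun x hx => by rw [hx]; exact hq)

/-- Carries facts that hold surely, such as independence of the returned sets, into the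
probabilistic calculus at no cost. -/
theorem Within.fails {p : Prog α} {Q : α → Prop} {T : ℕ} (hp : p.Within T Q) (δ : ℝ≥0∞) :
    p.Fails Q δ := by
  unfold Fails ev
  refine le_trans (le_of_eq ?_) (zero_le)
  rw [ENNReal.tsum_eq_zero]
  intro ω
  by_cases hω : ω ∈ p.law.support
  · simp [(hp ω hω).2]
  · rw [(PMF.apply_eq_zero_iff _ _).2 hω, zero_mul]

end Prog

open Prog

/-! ### Laws of the elementary programs -/

theorem law_step : step.law = PMF.pure ((), 1) := rfl

section

variable {U : Type}

theorem law_queryValue (f : Finset U → ℝ) (A : Finset U) :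
    (queryValue f A).law = PMF.pure (f A, 1) := rfl

open Classical in
theorem law_queryIndep (M : Matroid U) (A : Finset U) :
    (queryIndep M A).law = PMF.pure (decide (M.Indep (A : Set U)), 1) := rfl

theorem ev_drawSet (c : ℝ) (A : Finset U) (k : Finset U → ℝ≥0∞) :
    (drawSet c A).ev k = ∑' B, nu c A B * k B := by
  unfold ev
  have : (drawSet c A).law = PMF.bind (nu c A) fun B => PMF.pure (B, 1) := rfl
  rw [this, tsum_pmf_bind _ _ fun ω : Finset U × ℕ => k ω.1]
  simp_rw [tsum_pmf_pure _ fun ω : Finset U × ℕ => k ω.1]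

theorem within_drawSet (c : ℝ) (A : Finset U) :
    (drawSet c A).Within 1 fun B => B ∈ (nu c A).support := by
  intro ω hω
  have : (drawSet c A).law = PMF.bind (nu c A) fun B => PMF.pure (B, 1) := rfl
  rw [this] at hω
  simp only [PMF.mem_support_bind_iff, PMF.support_pure, Set.mem_singleton_iff] at hω
  obtain ⟨B, hB, rfl⟩ := hω
  exact ⟨le_rfl, hB⟩

end

/-! ## Diminishing returns -/

section DimReturns

variable {U : Type} [DecidableEq U]

/-- The marginals of `f` are nonincreasing. -/
def DimReturns (f : Finset U → ℝ) : Prop :=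
  ∀ (A B : Finset U) (x : U), A ⊆ B → f (insert x B) - f B ≤ f (insert x A) - f A

/-- Monotonicity enters only when `x ∈ B`: the marginal at `B` is then `0`, and the one at `A` has
to be nonnegative. -/
theorem SetFun.Submodular.dimReturns {f : Finset U → ℝ} (hs : SetFun.Submodular f)
    (hm : Monotone f) : DimReturns f := by
  intro A B x hAB
  by_cases hx : x ∈ B
  · rw [Finset.insert_eq_of_mem hx]
    have := hm (Finset.subset_insert x A)
    linarith
  · have h1 := hs (insert x A) B
    have h2 : insert x A ∪ B = insert x B := by
      rw [Finset.insert_union, Finset.union_eq_right.2 hAB]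
    have h3 : insert x A ∩ B = A := by
      rw [Finset.insert_inter_of_notMem hx, Finset.inter_eq_left.2 hAB]
    rw [h2, h3] at h1
    linarith

theorem DimReturns.union_le {f : Finset U → ℝ} (hd : DimReturns f) (A O : Finset U) :
    f (A ∪ O) - f A ≤ ∑ o ∈ O, (f (insert o A) - f A) := by
  induction O using Finset.induction_on with
  | empty => simp
  | insert o O ho ih =>
    rw [Finset.sum_insert ho, Finset.union_insert]
    have := hd A (A ∪ O) o Finset.subset_union_left
    linarith

theorem DimReturns.le_sum_singleton {f : Finset U → ℝ} (hd : DimReturns f) (h0 : f ∅ = 0)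
    (A : Finset U) : f A ≤ ∑ a ∈ A, f {a} := by
  simpa [h0] using hd.union_le ∅ A

theorem sum_singleton_le_union {f : Finset U → ℝ} {c : ℝ} (hc : SetFun.HasCurvature f c)
    (O D : Finset U) (h : Disjoint O D) :
    (1 - c) * ∑ b ∈ D, f {b} ≤ f (O ∪ D) - f O := by
  induction D using Finset.induction_on with
  | empty => simp
  | insert b D hb ih =>
    rw [Finset.disjoint_insert_right] at h
    rw [Finset.sum_insert hb, Finset.union_insert, mul_add]
    have := hc (O ∪ D) b (by simp [h.1, hb])
    have := ih h.2
    linarith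

/-- The contribution of all exchanges, restricted to a subset `B` of the current solution. -/
theorem exchange_marginals {f : Finset U → ℝ} {c : ℝ} (hd : DimReturns f)
    (h0 : f ∅ = 0) (hc : SetFun.HasCurvature f c) (hc1 : c ≤ 1) {S O B : Finset U} (hB : B ⊆ S)
    (π : U → U) (hinj : Set.InjOn π S) (himg : S.image π = O)
    (hfix : ∀ s ∈ S, π s ∈ S → π s = s) :
    f O - c * f B ≤ ∑ s ∈ S, (f (insert (π s) (B.erase s)) - f (B.erase s)) := by
  -- Passing from `B.erase s` to `B` would lose the whole marginal of an element of `B` fixed by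
  -- `π`. For these elements curvature recovers `(1 - c) f {s}`.
  have hterm : ∀ s ∈ S, (f (insert (π s) B) - f B) +
      (if π s = s ∧ s ∈ B then (1 - c) * f {s} else 0) ≤
      f (insert (π s) (B.erase s)) - f (B.erase s) := by
    intro s _
    split_ifs with h
    · rw [h.1, Finset.insert_eq_of_mem h.2, Finset.insert_erase h.2]
      have := hc (B.erase s) s (by simp)
      rw [Finset.insert_erase h.2] at this
      linarith
    · have := hd (B.erase s) B (π s) (Finset.erase_subset _ _)
      linarith
  refine le_trans ?_ (Finset.sum_le_sum hterm)
  rw [Finset.sum_add_distrib, ← Finset.sum_image (f := fun o => f (insert o B) - f B) hinj, himg,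
    ← Finset.sum_filter]
  have hset : S.filter (fun s => π s = s ∧ s ∈ B) = B ∩ O := by
    ext s
    simp only [Finset.mem_filter, Finset.mem_inter]
    constructor
    · rintro ⟨h1, h2, h3⟩
      refine ⟨h3, ?_⟩
      rw [← himg, ← h2]
      exact Finset.mem_image_of_mem _ h1
    · rintro ⟨h1, h2⟩
      rw [← himg] at h2
      obtain ⟨t, ht, rfl⟩ := Finset.mem_image.1 h2
      have h3 := hfix t ht (hB h1)
      rw [h3] at h1 ⊢
      exact ⟨hB h1, h3, h1⟩
  rw [hset, ← Finset.mul_sum]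
  have h1 := hd.union_le B O
  have h2 := sum_singleton_le_union hc O (B \ O) Finset.disjoint_sdiff
  have h3 : O ∪ B \ O = B ∪ O := by
    rw [Finset.union_sdiff_self_eq_union, Finset.union_comm]
  rw [h3] at h2
  have h4 := hd.le_sum_singleton h0 B
  rw [← Finset.sum_inter_add_sum_sdiff B O] at h4
  have h5 := mul_le_mul_of_nonneg_left h4 (sub_nonneg.2 hc1)
  rw [mul_add] at h5
  linarith

end DimReturns

/-! ## Random subsets -/

section RandomSubset

variable {U : Type}

/-- The expectation of `k` on the random subset of `A` that contains every element of `A`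
independently with probability `p`. -/
def subsetMean (A : Finset U) (p : ℝ) (k : Finset U → ℝ) : ℝ :=
  ∑ B ∈ A.powerset, p ^ B.card * (1 - p) ^ (A.card - B.card) * k B

theorem subsetMean_insert [DecidableEq U] {A : Finset U} {x : U} (hx : x ∉ A) (p : ℝ) (k : Finset U → ℝ) :
    subsetMean (insert x A) p k =
      p * subsetMean A p (fun B => k (insert x B)) + (1 - p) * subsetMean A p k := by
  unfold subsetMean
  rw [Finset.sum_powerset_insert hx, add_comm, Finset.mul_sum, Finset.mul_sum]
  congr 1
  · refine Finset.sum_congr rfl fun B hB => ?_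
    have hB := Finset.mem_powerset.1 hB
    rw [Finset.card_insert_of_notMem hx, Finset.card_insert_of_notMem (fun h => hx (hB h)),
      Nat.add_sub_add_right, pow_succ]
    ring
  · refine Finset.sum_congr rfl fun B hB => ?_
    have hB := Finset.card_le_card (Finset.mem_powerset.1 hB)
    rw [Finset.card_insert_of_notMem hx, Nat.succ_sub hB, pow_succ]
    ring

theorem subsetMean_congr {A : Finset U} {p : ℝ} {k l : Finset U → ℝ}
    (h : ∀ B, B ⊆ A → k B = l B) : subsetMean A p k = subsetMean A p l :=
  Finset.sum_congr rfl fun B hB => by rw [h B (Finset.mem_powerset.1 hB)]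

theorem subsetMean_sub (A : Finset U) (p : ℝ) (k l : Finset U → ℝ) :
    subsetMean A p (fun B => k B - l B) = subsetMean A p k - subsetMean A p l := by
  unfold subsetMean
  rw [← Finset.sum_sub_distrib]
  exact Finset.sum_congr rfl fun B _ => by ring

theorem subsetMean_mul (A : Finset U) (p a : ℝ) (k : Finset U → ℝ) :
    subsetMean A p (fun B => a * k B) = a * subsetMean A p k := by
  unfold subsetMean
  rw [Finset.mul_sum]
  exact Finset.sum_congr rfl fun B _ => by ring

theorem subsetMean_sum {ι : Type} (s : Finset ι) (A : Finset U) (p : ℝ)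
    (k : ι → Finset U → ℝ) :
    subsetMean A p (fun B => ∑ i ∈ s, k i B) = ∑ i ∈ s, subsetMean A p (k i) := by
  unfold subsetMean
  rw [Finset.sum_comm]
  exact Finset.sum_congr rfl fun B _ => by rw [Finset.mul_sum]

theorem subsetMean_const [DecidableEq U] (A : Finset U) (p a : ℝ) : subsetMean A p (fun _ => a) = a := by
  induction A using Finset.induction_on with
  | empty => simp [subsetMean]
  | insert x A hx ih => rw [subsetMean_insert hx, ih]; ring

theorem subsetMean_mono {A : Finset U} {p : ℝ} (hp : p ∈ Set.Icc (0 : ℝ) 1)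
    {k l : Finset U → ℝ} (h : ∀ B, B ⊆ A → k B ≤ l B) : subsetMean A p k ≤ subsetMean A p l := by
  refine Finset.sum_le_sum fun B hB => ?_
  have h1 := hp.1
  have h2 : 0 ≤ 1 - p := sub_nonneg.2 hp.2
  exact mul_le_mul_of_nonneg_left (h B (Finset.mem_powerset.1 hB)) (by positivity)

theorem subsetMean_zero [DecidableEq U] (A : Finset U) (k : Finset U → ℝ) : subsetMean A 0 k = k ∅ := by
  induction A using Finset.induction_on with
  | empty => simp [subsetMean]
  | insert x A hx ih => rw [subsetMean_insert hx, ih]; ring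

theorem subsetMean_one [DecidableEq U] (A : Finset U) (k : Finset U → ℝ) : subsetMean A 1 k = k A := by
  induction A using Finset.induction_on generalizing k with
  | empty => simp [subsetMean]
  | insert x A hx ih => rw [subsetMean_insert hx, ih]; ring

@[fun_prop]
theorem continuous_subsetMean (A : Finset U) (k : Finset U → ℝ) :
    Continuous fun p => subsetMean A p k := by
  unfold subsetMean
  fun_prop

theorem subsetMean_erase [DecidableEq U] {S : Finset U} {s : U} (hs : s ∈ S) (p : ℝ) (k : Finset U → ℝ) :
    subsetMean S p (fun B => k (B.erase s)) = subsetMean (S.erase s) p k := by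
  conv_lhs => rw [← Finset.insert_erase hs]
  rw [subsetMean_insert (Finset.notMem_erase s S)]
  have h1 : subsetMean (S.erase s) p (fun B => k ((insert s B).erase s)) =
      subsetMean (S.erase s) p k := by
    refine subsetMean_congr fun B hB => ?_
    rw [Finset.erase_insert fun h => Finset.notMem_erase s S (hB h)]
  have h2 : subsetMean (S.erase s) p (fun B => k (B.erase s)) =
      subsetMean (S.erase s) p k := by
    refine subsetMean_congr fun B hB => ?_
    rw [Finset.erase_eq_of_notMem fun h => Finset.notMem_erase s S (hB h)]
  rw [h1, h2]
  ring

/-- A random subset of `B` restricts to a random subset of `A`; adding the elements of `B \ A` one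
at a time makes this coupling explicit. -/
theorem subsetMean_antitone [DecidableEq U] {A B : Finset U} (hAB : A ⊆ B) {p : ℝ}
    (hp : p ∈ Set.Icc (0 : ℝ) 1) {k : Finset U → ℝ} (hk : Antitone k) :
    subsetMean B p k ≤ subsetMean A p k := by
  have key : ∀ T : Finset U, Disjoint A T → subsetMean (A ∪ T) p k ≤ subsetMean A p k := by
    intro T
    induction T using Finset.induction_on with
    | empty => simp
    | insert y T hy ih =>
      intro h
      rw [Finset.disjoint_insert_right] at h
      rw [Finset.union_insert, subsetMean_insert (by simp [h.1, hy])]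
      have h1 : subsetMean (A ∪ T) p (fun B => k (insert y B)) ≤ subsetMean (A ∪ T) p k :=
        subsetMean_mono hp fun B _ => hk (Finset.subset_insert y B)
      have h2 := mul_le_mul_of_nonneg_left h1 hp.1
      have h3 := ih h.2
      linarith
  have := key (B \ A) Finset.disjoint_sdiff
  rwa [Finset.union_sdiff_of_subset hAB] at this

/-- The mean is multilinear in the individual inclusion probabilities. Its derivative along the
diagonal is the sum of the partial derivatives, and the one in direction `s` is the expected
marginal of `s`. -/
theorem hasDerivAt_subsetMean [DecidableEq U] (A : Finset U) (k : Finset U → ℝ) (p : ℝ) :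
    HasDerivAt (fun p => subsetMean A p k)
      (∑ s ∈ A, subsetMean (A.erase s) p (fun B => k (insert s B) - k B)) p := by
  induction A using Finset.induction_on generalizing k with
  | empty =>
    have : (fun p => subsetMean (∅ : Finset U) p k) = fun _ => k ∅ := by
      funext p
      simp [subsetMean]
    rw [this]
    simpa using hasDerivAt_const p (k ∅)
  | insert x A hx ih =>
    have h1 : (fun p => subsetMean (insert x A) p k) = fun p =>
        p * subsetMean A p (fun B => k (insert x B)) + (1 - p) * subsetMean A p k := by
      funext p
      exact subsetMean_insert hx p k
    rw [h1]
    have h2 := ((hasDerivAt_id p).mul (ih fun B => k (insert x B))).add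
      (((hasDerivAt_const p (1 : ℝ)).sub (hasDerivAt_id p)).mul (ih k))
    refine h2.congr_deriv ?_
    rw [Finset.sum_insert hx, Finset.erase_insert hx, subsetMean_sub]
    have h3 : ∀ s ∈ A, subsetMean ((insert x A).erase s) p (fun B => k (insert s B) - k B) =
        p * subsetMean (A.erase s) p (fun B => k (insert x (insert s B)) - k (insert x B)) +
        (1 - p) * subsetMean (A.erase s) p (fun B => k (insert s B) - k B) := by
      intro s hs
      have hne : x ≠ s := fun h => hx (h ▸ hs)
      rw [Finset.erase_insert_of_ne hne, subsetMean_insert (fun h => hx (Finset.mem_of_mem_erase h))]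
      simp_rw [Finset.insert_comm s x]
    rw [Finset.sum_congr rfl h3, Finset.sum_add_distrib, ← Finset.mul_sum, ← Finset.mul_sum]
    simp only [id, Pi.sub_apply]
    ring

end RandomSubset

/-! ## The potential -/

section Potential

variable {U : Type}

/-- The density `c e^{cp} / (e^c - 1)`. -/
noncomputable def density (c p : ℝ) : ℝ := c * Real.exp (c * p) / (Real.exp c - 1)

/-- The potential `g A = ∑_{B ⊆ A} m_{|A|-1,|B|-1} f B`. -/
noncomputable def potential (c : ℝ) (f : Finset U → ℝ) (A : Finset U) : ℝ :=
  ∑ B ∈ A.powerset, gWeight c A B * f B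

@[fun_prop]
theorem continuous_density (c : ℝ) : Continuous (density c) := by
  unfold density
  fun_prop

theorem exp_sub_one_pos {c : ℝ} (hc : 0 < c) : 0 < Real.exp c - 1 := by
  linarith [Real.add_one_lt_exp hc.ne']

theorem density_nonneg {c : ℝ} (hc : 0 < c) (p : ℝ) : 0 ≤ density c p := by
  have := exp_sub_one_pos hc
  unfold density
  positivity

theorem density_le {c p : ℝ} (hc : 0 < c) (hp : p ≤ 1) : density c p ≤ density c 1 := by
  have := exp_sub_one_pos hc
  unfold density
  gcongr

theorem hasDerivAt_density (c p : ℝ) : HasDerivAt (density c) (c * density c p) p := by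
  unfold density
  have h := (((hasDerivAt_id p).const_mul c).exp.const_mul c).div_const (Real.exp c - 1)
  refine h.congr_deriv ?_
  simp only [id]
  ring

theorem integral_density {c : ℝ} (hc : 0 < c) : ∫ p in (0 : ℝ)..1, density c p = 1 := by
  have h : ∀ p ∈ Set.uIcc (0 : ℝ) 1,
      HasDerivAt (fun p => density c p / c) (density c p) p := by
    intro p _
    refine ((hasDerivAt_density c p).div_const c).congr_deriv ?_
    field_simp
  rw [intervalIntegral.integral_eq_sub_of_hasDerivAt h
    ((continuous_density c).intervalIntegrable _ _)]
  have := exp_sub_one_pos hc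
  unfold density
  simp only [mul_one, mul_zero, Real.exp_zero]
  field_simp

theorem potential_empty (c : ℝ) (f : Finset U → ℝ) : potential c f ∅ = 0 := by
  simp [potential, gWeight, mCoeff]

theorem gWeight_empty (c : ℝ) (A : Finset U) : gWeight c A ∅ = 0 := by
  simp [gWeight, mCoeff]

theorem gWeight_eq_integral (c : ℝ) {A B : Finset U} (hBA : B ⊆ A) (hB : B.Nonempty) :
    gWeight c A B =
      ∫ p in (0 : ℝ)..1, density c p * (p ^ (B.card - 1) * (1 - p) ^ (A.card - B.card)) := by
  have h1 := hB.card_pos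
  have h2 := Finset.card_le_card hBA
  unfold gWeight mCoeff
  rw [if_neg (by omega)]
  have h3 : ((B.card : ℤ) - 1).toNat = B.card - 1 := by omega
  have h4 : ((A.card : ℤ) - 1 - ((B.card : ℤ) - 1)).toNat = A.card - B.card := by omega
  rw [h3, h4]
  rfl

/-- The potential at `A`, before integrating over `p`. -/
noncomputable def potentialIntegrand (f : Finset U → ℝ) (A : Finset U) (p : ℝ) : ℝ :=
  ∑ B ∈ A.powerset.filter Finset.Nonempty, p ^ (B.card - 1) * (1 - p) ^ (A.card - B.card) * f B

@[fun_prop]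
theorem continuous_potentialIntegrand (f : Finset U → ℝ) (A : Finset U) :
    Continuous (potentialIntegrand f A) := by
  unfold potentialIntegrand
  fun_prop

theorem potential_eq_integral (c : ℝ) (f : Finset U → ℝ) (A : Finset U) :
    potential c f A = ∫ p in (0 : ℝ)..1, density c p * potentialIntegrand f A p := by
  unfold potential potentialIntegrand
  have h1 : ∑ B ∈ A.powerset, gWeight c A B * f B =
      ∑ B ∈ A.powerset.filter Finset.Nonempty, gWeight c A B * f B := by
    refine (Finset.sum_filter_of_ne fun B _ h => ?_).symm
    rw [Finset.nonempty_iff_ne_empty]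
    rintro rfl
    simp [gWeight_empty] at h
  rw [h1]
  simp_rw [Finset.mul_sum]
  rw [intervalIntegral.integral_finsetSum]
  · refine Finset.sum_congr rfl fun B hB => ?_
    rw [Finset.mem_filter, Finset.mem_powerset] at hB
    rw [gWeight_eq_integral c hB.1 hB.2, ← intervalIntegral.integral_mul_const]
    refine intervalIntegral.integral_congr fun p _ => ?_
    ring
  · intro B _
    apply Continuous.intervalIntegrable
    fun_prop

theorem mul_potentialIntegrand {f : Finset U → ℝ} (h0 : f ∅ = 0) (A : Finset U) (p : ℝ) :
    p * potentialIntegrand f A p = subsetMean A p f := by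
  unfold potentialIntegrand subsetMean
  have h1 : ∑ B ∈ A.powerset, p ^ B.card * (1 - p) ^ (A.card - B.card) * f B =
      ∑ B ∈ A.powerset.filter Finset.Nonempty, p ^ B.card * (1 - p) ^ (A.card - B.card) * f B := by
    refine (Finset.sum_filter_of_ne fun B _ h => ?_).symm
    rw [Finset.nonempty_iff_ne_empty]
    rintro rfl
    simp [h0] at h
  rw [h1, Finset.mul_sum]
  refine Finset.sum_congr rfl fun B hB => ?_
  have h2 := (Finset.mem_filter.1 hB).2.card_pos
  rw [show B.card = B.card - 1 + 1 by omega, pow_succ]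
  simp only [Nat.add_sub_cancel]
  ring

variable [DecidableEq U]

/-- Subsets avoiding `x` reproduce the old integrand times `1 - p`; subsets containing `x` give `E
f(B + x)`. The missing `p` times the old integrand is `E f(B)`, because `f ∅ = 0`. -/
theorem potentialIntegrand_insert {f : Finset U → ℝ} (h0 : f ∅ = 0) {A : Finset U} {x : U}
    (hx : x ∉ A) (p : ℝ) :
    potentialIntegrand f (insert x A) p - potentialIntegrand f A p =
      subsetMean A p (fun B => f (insert x B) - f B) := by
  rw [subsetMean_sub, ← mul_potentialIntegrand h0]
  have h : potentialIntegrand f (insert x A) p =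
      (1 - p) * potentialIntegrand f A p + subsetMean A p (fun B => f (insert x B)) := by
    unfold potentialIntegrand subsetMean
    rw [Finset.sum_filter, Finset.sum_powerset_insert hx, Finset.sum_filter, Finset.mul_sum]
    congr 1
    · refine Finset.sum_congr rfl fun B hB => ?_
      have hB := Finset.card_le_card (Finset.mem_powerset.1 hB)
      rw [Finset.card_insert_of_notMem hx, Nat.succ_sub hB, pow_succ]
      split_ifs <;> ring
    · refine Finset.sum_congr rfl fun B hB => ?_
      have hB := Finset.mem_powerset.1 hB
      rw [if_pos (Finset.insert_nonempty x B), Finset.card_insert_of_notMem hx,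
        Finset.card_insert_of_notMem (fun h => hx (hB h))]
      simp only [Nat.add_sub_add_right, Nat.add_sub_cancel]
  rw [h]
  ring

/-- The main tool for the potential: its marginals are averages of marginals of `f`, so inequalities
between marginals pass from `f` to the potential. -/
theorem potential_insert {f : Finset U → ℝ} (h0 : f ∅ = 0) (c : ℝ) {A : Finset U} {x : U}
    (hx : x ∉ A) :
    potential c f (insert x A) - potential c f A =
      ∫ p in (0 : ℝ)..1, density c p * subsetMean A p (fun B => f (insert x B) - f B) := by
  rw [potential_eq_integral, potential_eq_integral, ← intervalIntegral.integral_sub]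
  · refine intervalIntegral.integral_congr fun p _ => ?_
    rw [← potentialIntegrand_insert h0 hx]
    ring
  · apply Continuous.intervalIntegrable
    fun_prop
  · apply Continuous.intervalIntegrable
    fun_prop

theorem integral_density_mono {c : ℝ} (hc : 0 < c) {k l : ℝ → ℝ} (hk : Continuous k)
    (hl : Continuous l) (h : ∀ p ∈ Set.Icc (0 : ℝ) 1, k p ≤ l p) :
    ∫ p in (0 : ℝ)..1, density c p * k p ≤ ∫ p in (0 : ℝ)..1, density c p * l p := by
  refine intervalIntegral.integral_mono_on zero_le_one ?_ ?_ fun p hp =>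
    mul_le_mul_of_nonneg_left (h p hp) (density_nonneg hc p)
  · apply Continuous.intervalIntegrable
    fun_prop
  · apply Continuous.intervalIntegrable
    fun_prop

theorem integral_density_mul_const {c : ℝ} (hc : 0 < c) (a : ℝ) :
    ∫ p in (0 : ℝ)..1, density c p * a = a := by
  rw [intervalIntegral.integral_mul_const, integral_density hc, one_mul]

/-- The sum of the losses of the potential over all exchanges of a bijection. -/
theorem potential_exchange_sum_le {f : Finset U → ℝ} {c : ℝ} (hd : DimReturns f)
    (h0 : f ∅ = 0) (hcurv : SetFun.HasCurvature f c) (hc : 0 < c) (hc1 : c ≤ 1) {S O : Finset U}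
    (π : U → U) (hinj : Set.InjOn π S) (himg : S.image π = O)
    (hfix : ∀ s ∈ S, π s ∈ S → π s = s) :
    ∑ s ∈ S, (potential c f S - potential c f (insert (π s) (S.erase s))) ≤
      density c 1 * f S - f O := by
  have h1 : ∀ s ∈ S, potential c f S - potential c f (insert (π s) (S.erase s)) =
      ∫ p in (0 : ℝ)..1, density c p *
        (subsetMean (S.erase s) p (fun B => f (insert s B) - f B) -
          subsetMean S p (fun B => f (insert (π s) (B.erase s)) - f (B.erase s))) := by
    intro s hs
    have h2 := potential_insert h0 c (Finset.notMem_erase s S)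
    rw [Finset.insert_erase hs] at h2
    have h3 : π s ∉ S.erase s := by
      intro h
      have := hfix s hs (Finset.mem_of_mem_erase h)
      rw [this] at h
      exact Finset.notMem_erase s S h
    have h4 := potential_insert h0 c h3
    have h5 : potential c f S - potential c f (insert (π s) (S.erase s)) =
        (potential c f S - potential c f (S.erase s)) -
        (potential c f (insert (π s) (S.erase s)) - potential c f (S.erase s)) := by ring
    rw [h5, h2, h4, ← intervalIntegral.integral_sub]
    · refine intervalIntegral.integral_congr fun p _ => ?_
      rw [subsetMean_erase hs p fun B => f (insert (π s) B) - f B]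
      ring
    · apply Continuous.intervalIntegrable
      fun_prop
    · apply Continuous.intervalIntegrable
      fun_prop
  rw [Finset.sum_congr rfl h1, ← intervalIntegral.integral_finsetSum]
  swap
  · intro s _
    apply Continuous.intervalIntegrable
    fun_prop
  simp_rw [← Finset.mul_sum, Finset.sum_sub_distrib]
  -- The density satisfies `w' = c w`, so the integrand is the derivative of `w F` with `F` the mean
  -- of `f`. The boundary term at `0` vanishes as `F(0) = f ∅ = 0`.
  have h2 : ∫ p in (0 : ℝ)..1, density c p *
      (∑ s ∈ S, subsetMean (S.erase s) p (fun B => f (insert s B) - f B) +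
        c * subsetMean S p f) = density c 1 * f S := by
    have hder : ∀ p ∈ Set.uIcc (0 : ℝ) 1,
        HasDerivAt (fun p => density c p * subsetMean S p f) (density c p *
      (∑ s ∈ S, subsetMean (S.erase s) p (fun B => f (insert s B) - f B) +
        c * subsetMean S p f)) p := by
      intro p _
      refine ((hasDerivAt_density c p).mul (hasDerivAt_subsetMean S f p)).congr_deriv ?_
      ring
    rw [intervalIntegral.integral_eq_sub_of_hasDerivAt hder]
    · rw [subsetMean_one, subsetMean_zero, h0]
      ring
    · apply Continuous.intervalIntegrable
      fun_prop
  rw [← h2, ← integral_density_mul_const hc (f O), ← intervalIntegral.integral_sub]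
  · simp_rw [← mul_sub]
    refine integral_density_mono hc (by fun_prop) (by fun_prop) fun p hp => ?_
    have h3 : subsetMean S p (fun B => f O - c * f B) ≤
        subsetMean S p (fun B => ∑ s ∈ S, (f (insert (π s) (B.erase s)) - f (B.erase s))) :=
      subsetMean_mono hp fun B hB => exchange_marginals hd h0 hcurv hc1 hB π hinj himg hfix
    rw [subsetMean_sub, subsetMean_const, subsetMean_mul, subsetMean_sum] at h3
    linarith
  · apply Continuous.intervalIntegrable
    fun_prop
  · apply Continuous.intervalIntegrable
    fun_prop

end Potential

/-! ### Properties of the potential for functions that need not vanish at the empty set -/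

section PotentialBounds

variable {U : Type} [DecidableEq U]

/-- `f` with its value at `∅` replaced by `0`. -/
def zeroEmpty (f : Finset U → ℝ) : Finset U → ℝ := fun A => if A = ∅ then 0 else f A

/-- Makes the normalized theory available for `f / x`, whose value at `∅` is `f {x}`: the weight of
`∅` is `0`, so that value never enters the potential. -/
theorem potential_zeroEmpty (c : ℝ) (f : Finset U → ℝ) (A : Finset U) :
    potential c (zeroEmpty f) A = potential c f A := by
  refine Finset.sum_congr rfl fun B _ => ?_
  by_cases h : B = ∅
  · rw [h, gWeight_empty, zero_mul, zero_mul]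
  · rw [zeroEmpty, if_neg h]

theorem monotone_zeroEmpty {f : Finset U → ℝ} (hm : Monotone f) (h0 : 0 ≤ f ∅) :
    Monotone (zeroEmpty f) := by
  intro A B hAB
  unfold zeroEmpty
  split_ifs with h1 h2 h2
  · exact le_rfl
  · exact h0.trans (hm (Finset.empty_subset B))
  · rw [h2] at hAB
    exact absurd (Finset.subset_empty.1 hAB) h1
  · exact hm hAB

theorem dimReturns_zeroEmpty {f : Finset U → ℝ} (hd : DimReturns f) (h0 : 0 ≤ f ∅) :
    DimReturns (zeroEmpty f) := by
  intro A B x hAB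
  unfold zeroEmpty
  rw [if_neg (Finset.insert_ne_empty x A), if_neg (Finset.insert_ne_empty x B)]
  have := hd A B x hAB
  split_ifs with h1 h2 h2
  · rw [h1, h2]
  · rw [h1] at hAB
    exact absurd (Finset.subset_empty.1 hAB) h2
  · rw [h2] at this ⊢
    linarith
  · exact this

theorem antitone_marginal {f : Finset U → ℝ} (hd : DimReturns f) (x : U) :
    Antitone fun B => f (insert x B) - f B := fun A B hAB => hd A B x hAB

variable {f : Finset U → ℝ} {c : ℝ}

theorem potential_le_insert (hm : Monotone f) (h0 : 0 ≤ f ∅) (hc : 0 < c) (A : Finset U) (x : U) :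
    potential c f A ≤ potential c f (insert x A) := by
  by_cases hx : x ∈ A
  · rw [Finset.insert_eq_of_mem hx]
  rw [← sub_nonneg, ← potential_zeroEmpty c f, ← potential_zeroEmpty c f A,
    potential_insert rfl c hx]
  refine intervalIntegral.integral_nonneg zero_le_one fun p hp =>
    mul_nonneg (density_nonneg hc p) ?_
  rw [← subsetMean_const A p 0]
  exact subsetMean_mono hp fun B _ =>
    sub_nonneg.2 (monotone_zeroEmpty hm h0 (Finset.subset_insert x B))

theorem monotone_potential (hm : Monotone f) (h0 : 0 ≤ f ∅) (hc : 0 < c) :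
    Monotone (potential c f) := by
  intro A B hAB
  have key : ∀ T : Finset U, potential c f A ≤ potential c f (A ∪ T) := by
    intro T
    induction T using Finset.induction_on with
    | empty => simp
    | insert y T _ ih =>
      rw [Finset.union_insert]
      exact ih.trans (potential_le_insert hm h0 hc _ y)
  have := key B
  rwa [Finset.union_eq_right.2 hAB] at this

theorem potential_nonneg (hm : Monotone f) (h0 : 0 ≤ f ∅) (hc : 0 < c) (A : Finset U) :
    0 ≤ potential c f A := by
  rw [← potential_empty c f]
  exact monotone_potential hm h0 hc (Finset.empty_subset A)

theorem dimReturns_potential (hm : Monotone f) (h0 : 0 ≤ f ∅) (hd : DimReturns f) (hc : 0 < c) :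
    DimReturns (potential c f) := by
  intro A B x hAB
  by_cases hx : x ∈ B
  · rw [Finset.insert_eq_of_mem hx, sub_self, sub_nonneg]
    exact potential_le_insert hm h0 hc A x
  · simp_rw [← potential_zeroEmpty c f]
    rw [potential_insert rfl c hx, potential_insert rfl c fun h => hx (hAB h)]
    exact integral_density_mono hc (by fun_prop) (by fun_prop) fun p hp =>
      subsetMean_antitone hAB hp (antitone_marginal (dimReturns_zeroEmpty hd h0) x)

/-- When `A` is built up element by element, each marginal of the potential averages marginals at
subsets of the current set, and these are at least the marginal at the set itself. -/
theorem le_potential (h0 : 0 ≤ f ∅) (hd : DimReturns f) (hc : 0 < c) (A : Finset U) :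
    zeroEmpty f A ≤ potential c f A := by
  rw [← potential_zeroEmpty]
  induction A using Finset.induction_on with
  | empty => rw [potential_empty]; exact le_rfl
  | insert x A hx ih =>
    have h1 := potential_insert (f := zeroEmpty f) rfl c hx
    have h2 : zeroEmpty f (insert x A) - zeroEmpty f A ≤
        ∫ p in (0 : ℝ)..1, density c p *
          subsetMean A p (fun B => zeroEmpty f (insert x B) - zeroEmpty f B) := by
      rw [← integral_density_mul_const hc (zeroEmpty f (insert x A) - zeroEmpty f A)]
      refine integral_density_mono hc (by fun_prop) (by fun_prop) fun p hp => ?_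
      rw [← subsetMean_const A p (zeroEmpty f (insert x A) - zeroEmpty f A)]
      exact subsetMean_mono hp fun B hB => dimReturns_zeroEmpty hd h0 B A x hB
    linarith

omit [DecidableEq U] in
theorem potential_le_tau_mul (hm : Monotone f) (hc : 0 < c) (A : Finset U) :
    potential c f A ≤ tau c A * f A := by
  unfold potential tau
  rw [Finset.sum_mul]
  exact Finset.sum_le_sum fun B hB =>
    mul_le_mul_of_nonneg_left (hm (Finset.mem_powerset.1 hB)) (mCoeff_nonneg hc _ _)

theorem integral_one_sub_pow (n : ℕ) : ∫ p in (0 : ℝ)..1, (1 - p) ^ n = ((n + 1 : ℕ) : ℝ)⁻¹ := by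
  rw [intervalIntegral.integral_comp_sub_left (fun p : ℝ => p ^ n) 1, integral_pow]
  simp

/-- `τ` is the potential of the function that is `1` on nonempty sets. Its marginal at the random
subset is nonzero only if that subset is empty, which has probability `(1 - p)^{|A|}`; the integral
of this is `1 / (|A| + 1)`. -/
theorem tau_le (hc : 0 < c) (A : Finset U) : tau c A ≤ density c 1 * (harmonic A.card : ℝ) := by
  have htau : ∀ B : Finset U, tau c B = potential c (zeroEmpty fun _ => 1) B := by
    intro B
    rw [potential_zeroEmpty]
    simp [potential, tau]
  induction A using Finset.induction_on with
  | empty => rw [htau, potential_empty]; simp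
  | insert x A hx ih =>
    have h1 := potential_insert (f := zeroEmpty fun _ : Finset U => (1 : ℝ)) rfl c hx
    rw [← htau, ← htau] at h1
    rw [Finset.card_insert_of_notMem hx, harmonic_succ]
    push_cast
    have h2 : ∫ p in (0 : ℝ)..1, density c p * subsetMean A p (fun B =>
        zeroEmpty (fun _ => (1 : ℝ)) (insert x B) - zeroEmpty (fun _ => (1 : ℝ)) B) ≤
        density c 1 * ((A.card : ℝ) + 1)⁻¹ := by
      have h3 : ∀ p : ℝ, subsetMean A p (fun B =>
        zeroEmpty (fun _ => (1 : ℝ)) (insert x B) - zeroEmpty (fun _ => (1 : ℝ)) B) =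
          (1 - p) ^ A.card := by
        intro p
        unfold subsetMean zeroEmpty
        rw [Finset.sum_eq_single ∅]
        · simp
        · intro B _ hB
          simp [hB]
        · simp
      simp_rw [h3]
      have h4 := integral_one_sub_pow A.card
      push_cast at h4
      rw [← h4, ← intervalIntegral.integral_const_mul]
      refine intervalIntegral.integral_mono_on zero_le_one ?_ ?_ fun p hp => ?_
      · apply Continuous.intervalIntegrable
        fun_prop
      · apply Continuous.intervalIntegrable
        fun_prop
      · have : 0 ≤ 1 - p := sub_nonneg.2 hp.2
        exact mul_le_mul_of_nonneg_right (density_le hc hp.2) (by positivity)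
    have h5 : density c 1 * ((harmonic A.card : ℝ) + ((A.card : ℝ) + 1)⁻¹) =
        density c 1 * (harmonic A.card : ℝ) + density c 1 * ((A.card : ℝ) + 1)⁻¹ := mul_add _ _ _
    linarith

-- Exchanges preserve cardinality. Subtracting a constant from `f` therefore changes the potential
-- by the same amount before and after an exchange, so `f ∅` can be subtracted in the exchange
-- inequality.
omit [DecidableEq U] in
theorem tau_eq_of_card_eq {A B : Finset U} (h : A.card = B.card) : tau c A = tau c B := by
  unfold tau gWeight
  rw [Finset.sum_powerset_apply_card (fun m => mCoeff c ((A.card : ℤ) - 1) ((m : ℤ) - 1)),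
    Finset.sum_powerset_apply_card (fun m => mCoeff c ((B.card : ℤ) - 1) ((m : ℤ) - 1)), h]

omit [DecidableEq U] in
theorem potential_sub_const (c : ℝ) (f : Finset U → ℝ) (a : ℝ) (A : Finset U) :
    potential c (fun B => f B - a) A = potential c f A - a * tau c A := by
  unfold potential tau
  rw [Finset.mul_sum, ← Finset.sum_sub_distrib]
  exact Finset.sum_congr rfl fun B _ => by ring

/-- `potential_exchange_sum_le` for a set function that need not be normalized. -/
theorem potential_exchange_sum_le_sub (hd : DimReturns f)
    (hcurv : SetFun.HasCurvature (fun B => f B - f ∅) c) (hc : 0 < c) (hc1 : c ≤ 1)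
    {S O : Finset U} (π : U → U) (hinj : Set.InjOn π S) (himg : S.image π = O)
    (hfix : ∀ s ∈ S, π s ∈ S → π s = s) :
    ∑ s ∈ S, (potential c f S - potential c f (insert (π s) (S.erase s))) ≤
      density c 1 * (f S - f ∅) - (f O - f ∅) := by
  have hd' : DimReturns (fun B => f B - f ∅) := by
    intro A B x hAB
    have := hd A B x hAB
    simp only
    linarith
  refine le_trans (le_of_eq ?_)
    (potential_exchange_sum_le hd' (sub_self _) hcurv hc hc1 π hinj himg hfix)
  refine Finset.sum_congr rfl fun s hs => ?_
  have h1 : π s ∉ S.erase s := by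
    intro h
    have := hfix s hs (Finset.mem_of_mem_erase h)
    rw [this] at h
    exact Finset.notMem_erase s S h
  have h2 : (insert (π s) (S.erase s)).card = S.card := by
    rw [Finset.card_insert_of_notMem h1, Finset.card_erase_add_one hs]
  rw [potential_sub_const, potential_sub_const, tau_eq_of_card_eq h2]
  ring

end PotentialBounds

/-! ### Concentration of the sampled potential -/

section Sampling

variable {U : Type}

theorem ev_sampleSum_succ (f : Finset U → ℝ) (c : ℝ) (A : Finset U) (N : ℕ) (k : ℝ → ℝ≥0∞) :
    (sampleSum f c A (N + 1)).ev k =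
      ∑' B, nu c A B * (sampleSum f c A N).ev fun s => k (f B + s) := by
  rw [sampleSum]
  simp only [ev_bind, ev_drawSet, ev_of_law_pure (law_queryValue _ _), ev_of_law_pure law_step,
    ev_pure]

theorem ev_estimate (f : Finset U → ℝ) (c : ℝ) (A : Finset U) (N : ℕ) (k : ℝ → ℝ≥0∞) :
    (estimate f c N A).ev k = (sampleSum f c A N).ev fun s => k (tau c A * (s / N)) := by
  rw [estimate]
  simp only [ev_bind, ev_of_law_pure law_step, ev_pure]

theorem nu_apply {c : ℝ} (hc : 0 < c) {A : Finset U} (hA : A.Nonempty) {B : Finset U}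
    (hB : B ⊆ A) : nu c A B = ENNReal.ofReal (gWeight c A B / tau c A) := by
  unfold nu
  rw [dif_pos ⟨hc, hA⟩, PMF.ofFinset_apply, if_pos hB]

theorem nu_apply_of_not_subset {c : ℝ} (hc : 0 < c) {A : Finset U} (hA : A.Nonempty)
    {B : Finset U} (hB : ¬ B ⊆ A) : nu c A B = 0 := by
  unfold nu
  rw [dif_pos ⟨hc, hA⟩, PMF.ofFinset_apply, if_neg hB]

theorem sum_nu_toReal_mul [Fintype U] {c : ℝ} (hc : 0 < c) {A : Finset U} (hA : A.Nonempty)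
    (f : Finset U → ℝ) : ∑ B, (nu c A B).toReal * f B = potential c f A / tau c A := by
  classical
  rw [← Finset.sum_subset (Finset.subset_univ A.powerset)]
  · unfold potential
    rw [Finset.sum_div]
    refine Finset.sum_congr rfl fun B hB => ?_
    rw [nu_apply hc hA (Finset.mem_powerset.1 hB), ENNReal.toReal_ofReal
      (div_nonneg (show 0 ≤ gWeight c A B from mCoeff_nonneg hc _ _) (tau_pos hc hA).le)]
    ring
  · intro B _ hB
    rw [nu_apply_of_not_subset hc hA fun h => hB (Finset.mem_powerset.2 h)]
    simp

/-- Hoeffding's lemma for a sample from `ν_A`. -/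
theorem sum_nu_exp_le [Fintype U] {c : ℝ} (hc : 0 < c) {A : Finset U} (hA : A.Nonempty)
    {f : Finset U → ℝ} (hm : Monotone f) (h0 : 0 ≤ f ∅) (t : ℝ) :
    ∑ B, (nu c A B).toReal * Real.exp (t * (f B - potential c f A / tau c A)) ≤
      Real.exp (t ^ 2 * f A ^ 2 / 8) := by
  let _ : MeasurableSpace (Finset U) := ⊤
  have hms : MeasurableSingletonClass (Finset U) := ⟨fun _ => trivial⟩
  -- The range `[0, f A]` gives the variance proxy `(f A / 2)²`, hence the exponent `t² (f A)² / 8`.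
  have hb : ∀ᵐ B ∂(nu c A).toMeasure, f B ∈ Set.Icc (0 : ℝ) (f A) := by
    rw [MeasureTheory.ae_iff, PMF.toMeasure_apply_eq_zero_iff _ (by trivial)]
    rw [Set.disjoint_left]
    intro B hB hB'
    refine hB' ?_
    have hBA : B ⊆ A := by
      by_contra h
      exact hB (nu_apply_of_not_subset hc hA h)
    exact ⟨h0.trans (hm (Finset.empty_subset B)), hm hBA⟩
  have h := (ProbabilityTheory.hasSubgaussianMGF_of_mem_Icc
    (measurable_from_top (f := f)).aemeasurable hb).mgf_le t
  unfold ProbabilityTheory.mgf at h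
  rw [PMF.integral_eq_sum] at h
  simp only [PMF.integral_eq_sum, smul_eq_mul] at h
  rw [sum_nu_toReal_mul hc hA f] at h
  refine h.trans (le_of_eq ?_)
  congr 1
  push_cast
  rw [sub_zero, Real.norm_eq_abs, div_pow, sq_abs]
  ring

/-- Each draw is fresh, so the exponential moment factors and Hoeffding's lemma is used once per
sample. -/
theorem ev_sampleSum_exp_le [Fintype U] {c : ℝ} (hc : 0 < c) {A : Finset U} (hA : A.Nonempty)
    {f : Finset U → ℝ} (hm : Monotone f) (h0 : 0 ≤ f ∅) (t : ℝ) (N : ℕ) :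
    (sampleSum f c A N).ev
        (fun s => ENNReal.ofReal (Real.exp (t * (s - N * (potential c f A / tau c A))))) ≤
      ENNReal.ofReal (Real.exp (N * (t ^ 2 * f A ^ 2 / 8))) := by
  induction N with
  | zero =>
    rw [sampleSum, ev_pure]
    simp
  | succ N ih =>
    set m := potential c f A / tau c A with hmdef
    rw [ev_sampleSum_succ]
    have h1 : ∀ B s, ENNReal.ofReal (Real.exp (t * (f B + s - ((N + 1 : ℕ) : ℝ) * m))) =
        ENNReal.ofReal (Real.exp (t * (f B - m))) *
          ENNReal.ofReal (Real.exp (t * (s - N * m))) := by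
      intro B s
      rw [← ENNReal.ofReal_mul (Real.exp_pos _).le, ← Real.exp_add]
      congr 2
      push_cast
      ring
    simp_rw [h1, ev_mul_left, ← mul_assoc]
    rw [ENNReal.tsum_mul_right, tsum_fintype]
    have h2 : ∑ B, nu c A B * ENNReal.ofReal (Real.exp (t * (f B - m))) =
        ENNReal.ofReal (∑ B, (nu c A B).toReal * Real.exp (t * (f B - m))) := by
      rw [ENNReal.ofReal_sum_of_nonneg fun B _ => by positivity]
      refine Finset.sum_congr rfl fun B _ => ?_
      rw [ENNReal.ofReal_mul ENNReal.toReal_nonneg, ENNReal.ofReal_toReal (PMF.apply_ne_top _ _)]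
    rw [h2]
    refine (mul_le_mul' (ENNReal.ofReal_le_ofReal (sum_nu_exp_le hc hA hm h0 t)) ih).trans
      (le_of_eq ?_)
    rw [← ENNReal.ofReal_mul (Real.exp_pos _).le, ← Real.exp_add]
    congr 2
    push_cast
    ring

/-- `v` approximates `g` up to a relative error `ε`. -/
def Accurate (ε g v : ℝ) : Prop := |v - g| ≤ ε * g

/-- In a run on a function vanishing on all subsets of `A`, the sum of the samples is `0`. -/
theorem within_sampleSum_zero {c : ℝ} (hc : 0 < c) {A : Finset U} (hA : A.Nonempty)
    {f : Finset U → ℝ} (hf : ∀ B ⊆ A, f B = 0) (N : ℕ) :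
    (sampleSum f c A N).Within (3 * N) fun s => s = 0 := by
  induction N with
  | zero => exact within_pure rfl
  | succ N ih =>
    rw [sampleSum]
    refine Within.mono (S := 1 + (1 + (3 * N + (1 + 0)))) ?_ (by omega) fun _ h => h
    refine Within.bind (within_drawSet c A) fun B hB => ?_
    have hBA : B ⊆ A := by
      by_contra h
      exact hB (nu_apply_of_not_subset hc hA h)
    refine Within.det_bind (law_queryValue f B) ?_
    refine Within.bind ih fun s hs => ?_
    refine Within.det_bind law_step ?_
    exact within_pure (by rw [hf B hBA, hs, add_zero])

/-- Hoeffding's inequality. A relative error suffices without any lower bound on the values, because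
the range `f A` of a sample is at most the quantity `potential c f A` being estimated. -/
theorem fails_estimate [Fintype U] [DecidableEq U] {c ε : ℝ} (hc : 0 < c) (hε : 0 ≤ ε)
    {A : Finset U}
    (hA : A.Nonempty) {f : Finset U → ℝ} (hm : Monotone f) (h0 : 0 ≤ f ∅) (hd : DimReturns f)
    {N : ℕ} (hN : 0 < N) :
    (estimate f c N A).Fails (Accurate ε (potential c f A))
      (ENNReal.ofReal (2 * Real.exp (-(2 * N * (ε / tau c A) ^ 2)))) := by
  have hτ := tau_pos hc hA
  have hN' : (0 : ℝ) < N := by exact_mod_cast hN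
  have hfA : 0 ≤ f A := h0.trans (hm (Finset.empty_subset A))
  rcases hfA.eq_or_lt with hz | hpos
  · have hf : ∀ B ⊆ A, f B = 0 := fun B hB =>
      le_antisymm (hz ▸ hm hB) (h0.trans (hm (Finset.empty_subset B)))
    have hg : potential c f A = 0 :=
      Finset.sum_eq_zero fun B hB => by rw [hf B (Finset.mem_powerset.1 hB), mul_zero]
    rw [estimate]
    refine Within.fails (T := 3 * N + (1 + 0)) ?_ _
    refine Within.bind (within_sampleSum_zero hc hA hf N) fun s hs => ?_
    refine Within.det_bind law_step (within_pure ?_)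
    rw [hs, hg]
    simp [Accurate]
  set m := potential c f A / tau c A with hmdef
  have hg : potential c f A = tau c A * m := by
    rw [hmdef]
    field_simp
  have hfg : f A ≤ tau c A * m := by
    rw [← hg]
    have := le_potential h0 hd hc A
    rwa [zeroEmpty, if_neg hA.ne_empty] at this
  -- The minimizer of the Chernoff exponent `-t N ε m + N t² (f A)² / 8`.
  set t := 4 * ε * m / f A ^ 2 with ht
  have hm0 : 0 ≤ m := by
    by_contra h
    have := mul_neg_of_pos_of_neg hτ (not_le.1 h)
    linarith
  have ht0 : 0 ≤ t := by positivity
  have hexp : ∀ u : ℝ, u = t ∨ u = -t →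
      (sampleSum f c A N).ev (fun s => ENNReal.ofReal (Real.exp (-(t * (N * (ε * m))))) *
        ENNReal.ofReal (Real.exp (u * (s - N * m)))) ≤
      ENNReal.ofReal (Real.exp (-(2 * N * (ε / tau c A) ^ 2))) := by
    intro u hu
    rw [ev_mul_left]
    refine (mul_le_mul' le_rfl (ev_sampleSum_exp_le hc hA hm h0 u N)).trans ?_
    rw [← ENNReal.ofReal_mul (Real.exp_pos _).le, ← Real.exp_add]
    refine ENNReal.ofReal_le_ofReal (Real.exp_le_exp.2 ?_)
    have hu2 : u ^ 2 = t ^ 2 := by rcases hu with rfl | rfl <;> ring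
    rw [hu2]
    have h1 : -(t * (N * (ε * m))) + N * (t ^ 2 * f A ^ 2 / 8) =
        -(2 * N * (ε * m / f A) ^ 2) := by
      rw [ht]
      field_simp
      ring
    rw [h1]
    have h2 : ε / tau c A ≤ ε * m / f A := by
      rw [div_le_div_iff₀ hτ hpos]
      calc ε * f A ≤ ε * (tau c A * m) := by gcongr
        _ = ε * m * tau c A := by ring
    have h3 : (ε / tau c A) ^ 2 ≤ (ε * m / f A) ^ 2 := by gcongr
    have := mul_le_mul_of_nonneg_left h3 (by positivity : (0 : ℝ) ≤ 2 * N)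
    linarith
  unfold Fails
  rw [ev_estimate, two_mul, ENNReal.ofReal_add (Real.exp_pos _).le (Real.exp_pos _).le]
  refine le_trans ?_ (add_le_add (hexp t (Or.inl rfl)) (hexp (-t) (Or.inr rfl)))
  rw [← ev_add]
  refine ev_mono _ fun s => ?_
  by_cases hs : Accurate ε (potential c f A) (tau c A * (s / N))
  · simp [hs]
  · have h1 : Set.indicator {x | ¬ Accurate ε (potential c f A) x} (1 : ℝ → ℝ≥0∞)
        (tau c A * (s / N)) = 1 := by simp [hs]
    rw [h1]
    rw [← ENNReal.ofReal_mul (Real.exp_pos _).le, ← ENNReal.ofReal_mul (Real.exp_pos _).le,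
      ← Real.exp_add, ← Real.exp_add]
    unfold Accurate at hs
    have h2 : tau c A * (s / N) - potential c f A = tau c A / N * (s - N * m) := by
      rw [hg]
      field_simp
    have h3 : ε * potential c f A = tau c A / N * (N * (ε * m)) := by
      rw [hg]
      field_simp
    rw [h2, h3, not_le, abs_mul, abs_of_pos (div_pos hτ hN'),
      mul_lt_mul_iff_right₀ (div_pos hτ hN')] at hs
    rcases lt_abs.1 hs with h | h
    · refine le_trans ?_ le_self_add
      rw [ENNReal.one_le_ofReal, Real.one_le_exp_iff]
      have := mul_le_mul_of_nonneg_left h.le ht0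
      linarith
    · refine le_trans ?_ le_add_self
      rw [ENNReal.one_le_ofReal, Real.one_le_exp_iff]
      have := mul_le_mul_of_nonneg_left h.le ht0
      linarith

end Sampling

/-! ### Bases, contractions and exchange bijections -/

section Matroid

variable {U : Type} [Fintype U] {M : Matroid U}

theorem coe_matroidRank (M : Matroid U) : (matroidRank M : ℕ∞) = M.eRank := by
  obtain ⟨B, hB⟩ := M.exists_isBase
  unfold matroidRank
  rw [ENat.natCast_toNat]
  rw [← hB.encard_eq_eRank]
  exact (Set.toFinite B).encard_lt_top.ne

theorem Matroid.Indep.card_le_matroidRank {A : Finset U} (hA : M.Indep (A : Set U)) :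
    A.card ≤ matroidRank M := by
  have := hA.encard_le_eRank
  rw [← coe_matroidRank, Set.encard_coe_eq_coe_finsetCard] at this
  exact_mod_cast this

theorem Matroid.Indep.exists_finset_superset {A : Finset U} (hA : M.Indep (A : Set U)) :
    ∃ B : Finset U, A ⊆ B ∧ M.IsBase (B : Set U) ∧ B.card = matroidRank M := by
  obtain ⟨B, hB, hAB⟩ := hA.exists_isBase_superset
  obtain ⟨B, rfl⟩ : ∃ B' : Finset U, (B' : Set U) = B := ⟨(Set.toFinite B).toFinset, by simp⟩
  refine ⟨B, by exact_mod_cast hAB, hB, ?_⟩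
  have := hB.encard_eq_eRank
  rw [← coe_matroidRank, Set.encard_coe_eq_coe_finsetCard] at this
  exact_mod_cast this

theorem Matroid.Indep.isBase_of_card_eq {A : Finset U} (hA : M.Indep (A : Set U))
    (h : A.card = matroidRank M) : M.IsBase (A : Set U) := by
  obtain ⟨B, hAB, hB, hc⟩ := hA.exists_finset_superset
  rwa [Finset.eq_of_subset_of_card_le hAB (by omega)]

theorem mem_matroidGround {x : U} : x ∈ matroidGround M ↔ x ∈ M.E := by
  simp [matroidGround]

theorem Matroid.Indep.subset_matroidGround {A : Finset U} (hA : M.Indep (A : Set U)) :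
    A ⊆ matroidGround M := fun _ hx => mem_matroidGround.2 (hA.subset_ground hx)

variable [DecidableEq U]

omit [Fintype U] in
theorem contract_indep_iff_insert {x : U} (hx : M.Indep ({x} : Set U)) {A : Finset U} :
    (M.contract {x}).Indep (A : Set U) ↔ x ∉ A ∧ M.Indep ((insert x A : Finset U) : Set U) := by
  rw [hx.contract_indep_iff, Set.disjoint_singleton_right, Finset.coe_insert,
    Set.union_singleton, Finset.mem_coe]

theorem matroidRank_contract {x : U} (hx : M.Indep ({x} : Set U)) :
    matroidRank (M.contract {x}) + 1 = matroidRank M := by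
  have h0 : (M.contract {x}).Indep ((∅ : Finset U) : Set U) := by simp
  obtain ⟨B, -, hB, hc⟩ := h0.exists_finset_superset
  obtain ⟨h1, h2⟩ := (contract_indep_iff_insert hx).1 hB.indep
  have h3 := h2.card_le_matroidRank
  rw [Finset.card_insert_of_notMem h1] at h3
  have hx' : M.Indep (({x} : Finset U) : Set U) := by simpa using hx
  obtain ⟨D, hxD, hD, hcD⟩ := hx'.exists_finset_superset
  have hxD' : x ∈ D := by simpa using hxD
  have h4 : (M.contract {x}).Indep ((D.erase x : Finset U) : Set U) := by
    rw [contract_indep_iff_insert hx, Finset.insert_erase hxD']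
    exact ⟨Finset.notMem_erase x D, hD.indep⟩
  have h5 := h4.card_le_matroidRank
  rw [Finset.card_erase_of_mem hxD'] at h5
  omega

theorem card_matroidGround_contract (hM : M.E = Set.univ) (x : U) :
    (matroidGround (M.contract {x})).card + 1 = Fintype.card U := by
  have : matroidGround (M.contract {x}) = Finset.univ.erase x := by
    ext y
    rw [mem_matroidGround]
    simp [hM]
  rw [this, Finset.card_erase_of_mem (Finset.mem_univ x), Finset.card_univ]
  have : 0 < Fintype.card U := Fintype.card_pos_iff.2 ⟨x⟩
  omega

/-- Between two bases there is a bijection all of whose single exchanges are independent. -/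
theorem exists_exchange_bijection {S O : Finset U} (hS : M.Indep (S : Set U))
    (hO : M.Indep (O : Set U)) (hSc : S.card = matroidRank M) (hOc : O.card = matroidRank M) :
    ∃ π : U → U, Set.InjOn π S ∧ S.image π = O ∧
      ∀ s ∈ S, (π s ∈ S → π s = s) ∧ M.Indep ((insert (π s) (S.erase s) : Finset U) : Set U) := by
  classical
  -- The elements of `S` that may be exchanged for `o`. The requirement `o ∉ S.erase e` leaves only
  -- `e = o` when `o ∈ S`, so common elements are matched to themselves.
  let t : {o // o ∈ O} → Finset U := fun o => S.filter fun e =>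
    o.1 ∉ S.erase e ∧ M.Indep ((insert o.1 (S.erase e) : Finset U) : Set U)
  have htS : ∀ o, t o ⊆ S := fun o => Finset.filter_subset _ _
  -- For `o ∉ S`, the fundamental circuit of `o` minus `o` lies in `t o` and spans `o`.
  have hcl : ∀ o, o.1 ∈ M.closure (t o : Set U) := by
    intro o
    have htE : ((t o : Finset U) : Set U) ⊆ M.E :=
      Set.Subset.trans (Finset.coe_subset.2 (htS o)) hS.subset_ground
    by_cases ho : o.1 ∈ S
    · refine M.subset_closure _ htE ?_
      simp only [t, Finset.coe_filter, Set.mem_ofPred_eq]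
      refine ⟨ho, Finset.notMem_erase _ _, ?_⟩
      rwa [Finset.insert_erase ho]
    · have hoE : o.1 ∈ M.E := hO.subset_ground o.2
      have hocl : o.1 ∈ M.closure (S : Set U) := by
        rw [(hS.isBase_of_card_eq hSc).closure_eq]
        exact hoE
      have hC := hS.fundCircuit_isCircuit hocl (by simpa using ho)
      have hoC := hC.mem_closure_sdiff_singleton_of_mem (M.mem_fundCircuit o.1 S)
      refine M.closure_subset_closure ?_ hoC
      rintro e ⟨heC, heo⟩
      have heo : e ≠ o.1 := by simpa using heo
      have heS : e ∈ S := by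
        have := M.fundCircuit_subset_insert o.1 S heC
        simpa [heo] using this
      have hind := (hS.mem_fundCircuit_iff hocl (by simpa using ho)).1 heC
      simp only [t, Finset.coe_filter, Set.mem_ofPred_eq]
      refine ⟨heS, fun h => ho (Finset.mem_of_mem_erase h), ?_⟩
      rw [Finset.coe_insert, Finset.coe_erase,
        Set.insert_sdiff_singleton_comm (Ne.symm heo)]
      exact hind
  -- Hall's condition is a rank count: `T` is independent and spanned by the union of the sets `t
  -- o`, so that union has at least `|T|` elements.
  have hall : ∀ T : Finset {o // o ∈ O}, T.card ≤ (T.biUnion t).card := by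
    intro T
    have h1 : M.Indep ((T.image Subtype.val : Finset U) : Set U) := by
      refine hO.subset ?_
      intro y hy
      simp only [Finset.coe_image, Set.mem_image] at hy
      obtain ⟨z, -, rfl⟩ := hy
      exact z.2
    have h2 : ((T.image Subtype.val : Finset U) : Set U) ⊆
        M.closure ((T.biUnion t : Finset U) : Set U) := by
      intro y hy
      simp only [Finset.coe_image, Set.mem_image] at hy
      obtain ⟨z, hz, rfl⟩ := hy
      refine M.closure_subset_closure ?_ (hcl z)
      exact_mod_cast Finset.subset_biUnion_of_mem t hz
    have h3 := M.eRk_mono h2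
    rw [M.eRk_closure_eq, h1.eRk_eq_encard] at h3
    have h4 := h3.trans (M.eRk_le_encard _)
    rw [Set.encard_coe_eq_coe_finsetCard, Set.encard_coe_eq_coe_finsetCard,
      Finset.card_image_of_injective _ Subtype.val_injective] at h4
    exact_mod_cast h4
  obtain ⟨φ, hφ, hφt⟩ := (Finset.all_card_le_biUnion_card_iff_exists_injective t).1 hall
  have himg : Finset.univ.image φ = S := by
    refine Finset.eq_of_subset_of_card_le ?_ ?_
    · intro y hy
      obtain ⟨o, -, rfl⟩ := Finset.mem_image.1 hy
      exact htS o (hφt o)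
    · rw [Finset.card_image_of_injective _ hφ, Finset.card_univ, Fintype.card_coe]
      omega
  have hsurj : ∀ s ∈ S, ∃ o, φ o = s := by
    intro s hs
    rw [← himg] at hs
    simpa using hs
  let π : U → U := fun s => if h : s ∈ S then (hsurj s h).choose.1 else s
  have hπ : ∀ s (hs : s ∈ S), ∃ o : {o // o ∈ O}, φ o = s ∧ π s = o.1 := by
    intro s hs
    refine ⟨(hsurj s hs).choose, (hsurj s hs).choose_spec, ?_⟩
    simp only [π, dif_pos hs]
  have hπφ : ∀ o, π (φ o) = o.1 := by
    intro o
    obtain ⟨o', h1, h2⟩ := hπ (φ o) (htS o (hφt o))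
    rw [h2, hφ h1]
  refine ⟨π, ?_, ?_, ?_⟩
  · intro a ha b hb hab
    obtain ⟨o, rfl, h1⟩ := hπ a ha
    obtain ⟨o', rfl, h2⟩ := hπ b hb
    rw [h1, h2] at hab
    rw [Subtype.ext hab]
  · ext y
    rw [Finset.mem_image]
    constructor
    · rintro ⟨s, hs, rfl⟩
      obtain ⟨o, -, h⟩ := hπ s hs
      rw [h]
      exact o.2
    · intro hy
      exact ⟨φ ⟨y, hy⟩, htS _ (hφt _), hπφ ⟨y, hy⟩⟩
  · intro s hs
    obtain ⟨o, rfl, h1⟩ := hπ s hs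
    have h2 := hφt o
    simp only [t, Finset.mem_filter] at h2
    rw [h1]
    refine ⟨fun h => ?_, h2.2.2⟩
    by_contra hne
    exact h2.2.1 (Finset.mem_erase.2 ⟨hne, h⟩)

end Matroid

/-! ## Correctness of the search, given accurate estimates -/

section Search

variable {U : Type} [LinearOrder U] {M : Matroid U} {f g : Finset U → ℝ} {c ε : ℝ} {N : ℕ}
  {δ : ℝ≥0∞}

/-- The state of `bestExtension` after the candidates in `l`. -/
def BestInv (M : Matroid U) (g : Finset U → ℝ) (ε : ℝ) (S : Finset U) (l : List U) :
    Option (U × ℝ) → Prop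
  | none => ∀ y ∈ l, ¬ M.Indep ((insert y S : Finset U) : Set U)
  | some (z, u) => z ∈ l ∧ M.Indep ((insert z S : Finset U) : Set U) ∧
      Accurate ε (g (insert z S)) u ∧
      ∀ y ∈ l, M.Indep ((insert y S : Finset U) : Set U) → (1 - ε) * g (insert y S) ≤ u

theorem BestInv.skip {S : Finset U} {l : List U} {best : Option (U × ℝ)} {y : U}
    (h : BestInv M g ε S l best) (hy : ¬ M.Indep ((insert y S : Finset U) : Set U)) :
    BestInv M g ε S (l ++ [y]) best := by
  match best, h with
  | none, h =>
    intro z hz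
    rcases List.mem_append.1 hz with hz | hz
    · exact h z hz
    · rwa [List.mem_singleton.1 hz]
  | some (z, u), h =>
    refine ⟨List.mem_append_left _ h.1, h.2.1, h.2.2.1, fun w hw hi => ?_⟩
    rcases List.mem_append.1 hw with hw | hw
    · exact h.2.2.2 w hw hi
    · rw [List.mem_singleton.1 hw] at hi
      exact absurd hi hy

theorem Accurate.le {a v : ℝ} (h : Accurate ε a v) : (1 - ε) * a ≤ v := by
  have := (abs_le.1 h).1
  linarith

theorem Accurate.ge {a v : ℝ} (h : Accurate ε a v) : v ≤ (1 + ε) * a := by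
  have := (abs_le.1 h).2
  linarith

theorem fails_bestExtension
    (hest : ∀ A : Finset U, A.Nonempty → M.Indep (A : Set U) →
      (estimate f c N A).Fails (Accurate ε (g A)) δ)
    (S : Finset U) (ys : List U) (l : List U) (best : Option (U × ℝ))
    (hinv : BestInv M g ε S l best) :
    (bestExtension M f c N S ys best).Fails (BestInv M g ε S (l ++ ys)) (ys.length * δ) := by
  induction ys generalizing l best with
  | nil =>
    rw [bestExtension, List.append_nil]
    exact fails_pure hinv _
  | cons y ys ih =>
    have happ : l ++ y :: ys = (l ++ [y]) ++ ys := by simp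
    have hlen : (((y :: ys).length : ℕ) : ℝ≥0∞) * δ = δ + ys.length * δ := by
      rw [List.length_cons]
      push_cast
      ring
    rw [bestExtension, happ]
    refine Fails.det_bind (law_queryIndep M _) ?_
    by_cases hy : M.Indep ((insert y S : Finset U) : Set U)
    · rw [if_pos (by simpa using hy), hlen]
      refine Fails.bind (hest _ (Finset.insert_nonempty y S) hy) fun w hw => ?_
      refine Fails.det_bind law_step ?_
      match best, hinv with
      | none, hinv =>
        refine ih _ _ ⟨by simp, hy, hw, fun z hz hi => ?_⟩
        rcases List.mem_append.1 hz with hz | hz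
        · exact absurd hi (hinv z hz)
        · rw [List.mem_singleton.1 hz]
          exact hw.le
      | some (z, u), hinv =>
        simp only
        split_ifs with huw
        · refine ih _ _ ⟨by simp, hy, hw, fun z hz hi => ?_⟩
          rcases List.mem_append.1 hz with hz | hz
          · exact (hinv.2.2.2 z hz hi).trans huw.le
          · rw [List.mem_singleton.1 hz]
            exact hw.le
        · refine ih _ _ ⟨List.mem_append_left _ hinv.1, hinv.2.1, hinv.2.2.1, fun z hz hi => ?_⟩
          rcases List.mem_append.1 hz with hz | hz
          · exact hinv.2.2.2 z hz hi
          · rw [List.mem_singleton.1 hz]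
            exact hw.le.trans (not_lt.1 huw)
    · rw [if_neg (by simpa using hy)]
      refine (ih _ _ (hinv.skip hy)).mono (fun _ h => h) ?_
      rw [hlen]
      exact le_add_self

/-- The outcome of the scan of a list of exchanges. -/
def ExchangePost (M : Matroid U) (g : Finset U → ℝ) (ε : ℝ) (S : Finset U) (v : ℝ)
    (l : List (U × U)) : Option (Finset U × ℝ) → Prop
  | none => ∀ p ∈ l, M.Indep ((insert p.2 (S.erase p.1) : Finset U) : Set U) →
      (1 - ε) * g (insert p.2 (S.erase p.1)) ≤ (1 + ε) * v
  | some (S', v') => (∃ p ∈ l, S' = insert p.2 (S.erase p.1)) ∧ M.Indep (S' : Set U) ∧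
      Accurate ε (g S') v' ∧ (1 + ε) * v < v'

theorem fails_findExchange
    (hest : ∀ A : Finset U, A.Nonempty → M.Indep (A : Set U) →
      (estimate f c N A).Fails (Accurate ε (g A)) δ)
    (S : Finset U) (v : ℝ) (l : List (U × U)) :
    (findExchange M f c N ε S v l).Fails (ExchangePost M g ε S v l) (l.length * δ) := by
  induction l with
  | nil =>
    rw [findExchange]
    exact fails_pure (fun p hp => by simp at hp) _
  | cons p l ih =>
    obtain ⟨e, x⟩ := p
    have hlen : ((((e, x) :: l).length : ℕ) : ℝ≥0∞) * δ = δ + l.length * δ := by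
      rw [List.length_cons]
      push_cast
      ring
    have hcons : ∀ out, ExchangePost M g ε S v l out →
        (M.Indep ((insert x (S.erase e) : Finset U) : Set U) →
          (1 - ε) * g (insert x (S.erase e)) ≤ (1 + ε) * v) →
        ExchangePost M g ε S v ((e, x) :: l) out := by
      intro out h hx
      match out, h with
      | none, h =>
        intro p hp
        rcases List.mem_cons.1 hp with rfl | hp
        · exact hx
        · exact h p hp
      | some (S', v'), h =>
        obtain ⟨⟨p, hp, hS⟩, h⟩ := h
        exact ⟨⟨p, List.mem_cons_of_mem _ hp, hS⟩, h⟩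
    rw [findExchange, hlen]
    refine Fails.det_bind (law_queryIndep M _) ?_
    by_cases hy : M.Indep ((insert x (S.erase e) : Finset U) : Set U)
    · rw [if_pos (by simpa using hy)]
      refine Fails.bind (hest _ (Finset.insert_nonempty x _) hy) fun w hw => ?_
      refine Fails.det_bind law_step ?_
      split_ifs with huw
      · exact fails_pure ⟨⟨(e, x), by simp, rfl⟩, hy, hw, huw⟩ _
      · exact ih.mono (fun out h => hcons out h fun _ => hw.le.trans (not_lt.1 huw)) le_rfl
    · rw [if_neg (by simpa using hy)]
      exact ih.mono (fun out h => hcons out h fun h => absurd h hy) le_add_self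

/-- The greedy guarantee for the set `S`: the marginals of every independent set that is not
larger than `S` are bounded in terms of `g S`. -/
def GreedyInv (M : Matroid U) (g : Finset U → ℝ) (ε : ℝ) (S : Finset U) : Prop :=
  ∀ O : Finset U, M.Indep (O : Set U) → O.card ≤ S.card →
    ∑ o ∈ O, (g (insert o S) - g S) ≤ (1 + 3 * ε * S.card) * g S

theorem greedyInv_empty (h0 : g ∅ = 0) : GreedyInv M g ε ∅ := by
  intro O _ hO
  rw [Finset.card_empty, Nat.le_zero, Finset.card_eq_zero] at hO
  rw [hO, h0]
  simp

/-- When `O` outgrows `S`, augmentation gives `o ∈ O` that competed with `y` in this round. Its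
marginal is at most `(1 + 3ε) g(S + y) - g S`, and the term `- g S` cancels the main term of the
bound for `O - o`. -/
theorem GreedyInv.insert {S : Finset U} (hg : Monotone g) (hg0 : 0 ≤ g ∅) (hd : DimReturns g)
    (hε : 0 ≤ ε) (hε3 : ε ≤ 1 / 3) (hinv : GreedyInv M g ε S) (hS : M.Indep (S : Set U)) {y : U}
    (hy : y ∉ S)
    (hbest : ∀ o, o ∉ S → M.Indep ((insert o S : Finset U) : Set U) →
      (1 - ε) * g (insert o S) ≤ (1 + ε) * g (insert y S)) :
    GreedyInv M g ε (insert y S) := by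
  have hSy : g S ≤ g (Insert.insert y S) := hg (Finset.subset_insert y S)
  have hS0 : 0 ≤ g S := hg0.trans (hg (Finset.empty_subset S))
  have hbound : ∀ T : Finset U, M.Indep (T : Set U) → T.card ≤ S.card →
      ∑ o ∈ T, (g (Insert.insert o (Insert.insert y S)) - g (Insert.insert y S)) ≤
        (1 + 3 * ε * S.card) * g S := fun T hT hTc =>
    (Finset.sum_le_sum fun o _ => hd S (Insert.insert y S) o (Finset.subset_insert y S)).trans
      (hinv T hT hTc)
  intro O hO hOc
  rw [Finset.card_insert_of_notMem hy] at hOc ⊢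
  push_cast
  rcases Nat.lt_or_ge S.card O.card with hlt | hge
  · obtain ⟨o, hoO, hoS, ho⟩ := hS.augment_finset hO hlt
    rw [← Finset.sum_erase_add _ _ hoO]
    have h1 := hbound (O.erase o) (hO.subset (by simp))
      (by rw [Finset.card_erase_of_mem hoO]; omega)
    have h2 := hd S (Insert.insert y S) o (Finset.subset_insert y S)
    have h3 := hbest o hoS (by rwa [Finset.coe_insert])
    have h4 : g (Insert.insert o S) ≤ (1 + 3 * ε) * g (Insert.insert y S) := by
      -- Two inaccurate estimates were compared; `(1 + ε) / (1 - ε) ≤ 1 + 3ε` holds for `ε ≤ 1/3`.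
      have h5 : (1 + ε) * g (Insert.insert y S) ≤
          (1 - ε) * ((1 + 3 * ε) * g (Insert.insert y S)) := by
        have : (1 + ε) ≤ (1 - ε) * (1 + 3 * ε) := by nlinarith
        rw [← mul_assoc]
        exact mul_le_mul_of_nonneg_right this (hS0.trans hSy)
      exact le_of_mul_le_mul_left (h3.trans h5) (by linarith)
    have h6 : (3 * ε * S.card) * g S ≤ (3 * ε * S.card) * g (Insert.insert y S) := by gcongr
    linarith
  · refine (hbound O hO hge).trans ?_
    gcongr
    linarith

theorem fails_greedyPhase [Fintype U] (hg : Monotone g) (hg0 : 0 ≤ g ∅) (hd : DimReturns g)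
    (hε : 0 ≤ ε) (hε3 : ε ≤ 1 / 3)
    (hest : ∀ A : Finset U, A.Nonempty → M.Indep (A : Set U) →
      (estimate f c N A).Fails (Accurate ε (g A)) δ)
    (k : ℕ) (S : Finset U) (hS : M.Indep (S : Set U)) (hk : S.card + k = matroidRank M)
    (hinv : GreedyInv M g ε S) :
    (greedyPhase M f c N (matroidGround M) k S).Fails
      (fun S' => M.Indep (S' : Set U) ∧ S'.card = matroidRank M ∧ GreedyInv M g ε S')
      ((k * (matroidGround M).card : ℕ) * δ) := by
  induction k generalizing S with
  | zero =>
    rw [greedyPhase]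
    exact fails_pure ⟨hS, by omega, hinv⟩ _
  | succ k ih =>
    rw [greedyPhase]
    have hmem : ∀ y, y ∈ ([] ++ (matroidGround M \ S).sort : List U) ↔
        y ∈ matroidGround M \ S := by simp
    have hlen : ((matroidGround M \ S).sort.length : ℝ≥0∞) * δ +
        (k * (matroidGround M).card : ℕ) * δ ≤ ((k + 1) * (matroidGround M).card : ℕ) * δ := by
      rw [← add_mul, ← Nat.cast_add]
      gcongr
      rw [Finset.length_sort, add_mul, one_mul, add_comm]
      gcongr
      exact Finset.sdiff_subset
    have hempty : BestInv M g ε S [] none := by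
      intro y hy
      simp at hy
    have hscan := fails_bestExtension hest S (matroidGround M \ S).sort [] none hempty
    refine Fails.mono (hscan.bind fun best hbest => ?_) (fun _ h => h) hlen
    match best, hbest with
    | none, hbest =>
      exfalso
      have h0 : M.Indep ((∅ : Finset U) : Set U) := by simp
      obtain ⟨B, -, hB, hBc⟩ := h0.exists_finset_superset
      obtain ⟨e, heB, heS, he⟩ := hS.augment_finset hB.indep (by omega)
      refine hbest e ?_ (by rwa [Finset.coe_insert])
      rw [hmem, Finset.mem_sdiff]
      exact ⟨hB.indep.subset_matroidGround heB, heS⟩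
    | some (y, u), hbest =>
      obtain ⟨hy, hyi, hacc, hmax⟩ := hbest
      rw [hmem, Finset.mem_sdiff] at hy
      refine ih (insert y S) hyi (by rw [Finset.card_insert_of_notMem hy.2]; omega) ?_
      refine hinv.insert hg hg0 hd hε hε3 hS hy.2 fun o ho hoi => ?_
      refine (hmax o ?_ hoi).trans hacc.ge
      rw [hmem, Finset.mem_sdiff]
      exact ⟨hoi.subset_matroidGround (Finset.mem_insert_self o S), ho⟩

/-- Every base has potential at most `(2 + 3 r ε) g S`. -/
theorem GreedyInv.le_mul {S O : Finset U} (hg : Monotone g) (hd : DimReturns g)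
    (hinv : GreedyInv M g ε S) (hO : M.Indep (O : Set U)) (hOS : O.card ≤ S.card) :
    g O ≤ (2 + 3 * S.card * ε) * g S := by
  have h1 := hinv O hO hOS
  have h2 := hd.union_le S O
  have h3 : g O ≤ g (S ∪ O) := hg Finset.subset_union_right
  linarith

/-- The guarantee for the output of the local search. -/
def LocalOpt [Fintype U] (M : Matroid U) (g : Finset U → ℝ) (ε : ℝ) (S : Finset U) : Prop :=
  M.Indep (S : Set U) ∧ S.card = matroidRank M ∧
    ∀ e ∈ S, ∀ x ∉ S, M.Indep ((insert x (S.erase e) : Finset U) : Set U) →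
      (1 - ε) * g (insert x (S.erase e)) ≤ (1 + ε) ^ 2 * g S

theorem length_product_sort_le (S E : Finset U) :
    (S.sort.product (E \ S).sort).length ≤ S.card * E.card := by
  have : (S.sort.product (E \ S).sort).length = S.card * (E \ S).card := by
    refine (List.length_product _ _).trans ?_
    rw [Finset.length_sort, Finset.length_sort]
  rw [this]
  gcongr
  exact Finset.sdiff_subset

theorem mem_product_sort {S T : Finset U} {p : U × U} :
    p ∈ S.sort.product T.sort ↔ p.1 ∈ S ∧ p.2 ∈ T := by
  obtain ⟨a, b⟩ := p
  refine List.mem_product.trans ?_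
  rw [Finset.mem_sort, Finset.mem_sort]

theorem card_exchange {S : Finset U} {e x : U} (he : e ∈ S) (hx : x ∉ S) :
    (insert x (S.erase e)).card = S.card := by
  rw [Finset.card_insert_of_notMem fun h => hx (Finset.mem_of_mem_erase h),
    Finset.card_erase_add_one he]

/-- Each exchange multiplies the stored value by more than `1 + ε`, while accuracy keeps it at most
`(1 + ε) G`. The invariant says that the remaining `k` iterations would reach this cap. -/
theorem fails_localSearch [Fintype U] (hε : 0 ≤ ε)
    (hest : ∀ A : Finset U, A.Nonempty → M.Indep (A : Set U) →
      (estimate f c N A).Fails (Accurate ε (g A)) δ)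
    {G : ℝ} (hG : ∀ A : Finset U, M.Indep (A : Set U) → A.card = matroidRank M → g A ≤ G)
    (k : ℕ) (S : Finset U) (v : ℝ) (hS : M.Indep (S : Set U)) (hSc : S.card = matroidRank M)
    (hv : Accurate ε (g S) v) (hk : (1 + ε) * G ≤ (1 + ε) ^ k * v)
    (hk0 : k = 0 → (1 + ε) * G < v) :
    (localSearch M f c N ε (matroidGround M) k S v).Fails
      (fun out => ∃ S', out = some S' ∧ LocalOpt M g ε S')
      ((k * (matroidRank M * (matroidGround M).card) : ℕ) * δ) := by
  induction k generalizing S v with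
  | zero =>
    -- With accurate estimates the error outcome cannot occur: the strict inequality `hk0` places
    -- `v` above its cap. Strictness comes from the last accepted exchange.
    exfalso
    have h1 := hk0 rfl
    have h2 := hv.ge
    have h3 := mul_le_mul_of_nonneg_left (hG S hS hSc) (by linarith : 0 ≤ 1 + ε)
    linarith
  | succ k ih =>
    rw [localSearch]
    have hlen : ((S.sort.product (matroidGround M \ S).sort).length : ℝ≥0∞) * δ +
        (k * (matroidRank M * (matroidGround M).card) : ℕ) * δ ≤
        ((k + 1) * (matroidRank M * (matroidGround M).card) : ℕ) * δ := by
      rw [← add_mul, ← Nat.cast_add]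
      gcongr
      rw [add_mul, one_mul, add_comm, ← hSc]
      gcongr
      exact length_product_sort_le S _
    refine Fails.mono (Fails.bind (fails_findExchange hest S v _) fun ex hex => ?_)
      (fun _ h => h) hlen
    match ex, hex with
    | none, hex =>
      refine fails_pure ⟨S, rfl, hS, hSc, fun e he x hx hi => ?_⟩ _
      refine (hex (e, x) (mem_product_sort.2 ⟨he, Finset.mem_sdiff.2 ⟨?_, hx⟩⟩) hi).trans ?_
      · exact hi.subset_matroidGround (Finset.mem_insert_self x _)
      -- One factor `1 + ε` is the acceptance threshold, the other the error of the stored estimate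
      -- `v`.
      · rw [sq, mul_assoc]
        exact mul_le_mul_of_nonneg_left hv.ge (by linarith)
    | some (S', v'), hex =>
      obtain ⟨⟨⟨e, x⟩, hp, rfl⟩, hi, hacc, hlt⟩ := hex
      rw [mem_product_sort, Finset.mem_sdiff] at hp
      refine ih _ v' hi (by rw [card_exchange hp.1 hp.2.2, hSc]) hacc ?_ fun hk0 => ?_
      · refine hk.trans ?_
        rw [pow_succ, mul_assoc]
        gcongr
      · rw [hk0] at hk
        simp only [zero_add, pow_one] at hk
        linarith

end Search

/-! ## The number of steps, and properties that hold in every execution -/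

section Steps

variable {U : Type}

theorem within_sampleSum (f : Finset U → ℝ) (c : ℝ) (A : Finset U) (N : ℕ) :
    (sampleSum f c A N).Within (3 * N) fun _ => True := by
  induction N with
  | zero => exact within_pure trivial
  | succ N ih =>
    rw [sampleSum]
    refine Within.mono (S := 1 + (1 + (3 * N + (1 + 0)))) ?_ (by omega) fun _ h => h
    refine Within.bind (within_drawSet c A) fun B _ => ?_
    refine Within.det_bind (law_queryValue f B) ?_
    refine Within.bind ih fun s _ => ?_
    exact Within.det_bind law_step (within_pure trivial)

theorem within_estimate (f : Finset U → ℝ) (c : ℝ) (A : Finset U) (N : ℕ) :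
    (estimate f c N A).Within (3 * N + 1) fun _ => True := by
  rw [estimate]
  refine Within.bind (within_sampleSum f c A N) fun s _ => ?_
  exact Within.det_bind (T := 0) law_step (within_pure trivial)

variable [LinearOrder U] {M : Matroid U}

/-- What is known in every execution after scanning the candidates in `l`. -/
def BestSound (M : Matroid U) (S : Finset U) (l : List U) : Option (U × ℝ) → Prop
  | none => ∀ y ∈ l, ¬ M.Indep ((insert y S : Finset U) : Set U)
  | some (z, _) => z ∈ l ∧ M.Indep ((insert z S : Finset U) : Set U)

theorem BestSound.skip {S : Finset U} {l : List U} {best : Option (U × ℝ)} {y : U}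
    (h : BestSound M S l best) (hy : ¬ M.Indep ((insert y S : Finset U) : Set U)) :
    BestSound M S (l ++ [y]) best := by
  match best, h with
  | none, h =>
    intro z hz
    rcases List.mem_append.1 hz with hz | hz
    · exact h z hz
    · rwa [List.mem_singleton.1 hz]
  | some (z, u), h => exact ⟨List.mem_append_left _ h.1, h.2⟩

theorem within_bestExtension (f : Finset U → ℝ) (c : ℝ) (N : ℕ) (S : Finset U) (ys l : List U)
    (best : Option (U × ℝ)) (hinv : BestSound M S l best) :
    (bestExtension M f c N S ys best).Within (ys.length * (3 * N + 3))
      (BestSound M S (l ++ ys)) := by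
  induction ys generalizing l best with
  | nil =>
    rw [bestExtension, List.append_nil]
    exact within_pure hinv
  | cons y ys ih =>
    have happ : l ++ y :: ys = (l ++ [y]) ++ ys := by simp
    have hlen : (y :: ys).length * (3 * N + 3) =
        1 + ((3 * N + 1) + (1 + ys.length * (3 * N + 3))) := by
      rw [List.length_cons]
      ring
    rw [bestExtension, happ, hlen]
    refine Within.det_bind (law_queryIndep M _) ?_
    by_cases hy : M.Indep ((insert y S : Finset U) : Set U)
    · rw [if_pos (by simpa using hy)]
      refine Within.bind (within_estimate f c _ N) fun w _ => ?_
      refine Within.det_bind law_step ?_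
      match best, hinv with
      | none, hinv => exact ih _ _ ⟨by simp, hy⟩
      | some (z, u), hinv =>
        simp only
        split_ifs
        · exact ih _ _ ⟨by simp, hy⟩
        · exact ih _ _ ⟨List.mem_append_left _ hinv.1, hinv.2⟩
    · rw [if_neg (by simpa using hy)]
      exact (ih _ _ (hinv.skip hy)).mono (by omega) fun _ h => h

theorem within_greedyPhase [Fintype U] (f : Finset U → ℝ) (c : ℝ) (N : ℕ) (k : ℕ) (S : Finset U)
    (hS : M.Indep (S : Set U)) (hk : S.card + k = matroidRank M) :
    (greedyPhase M f c N (matroidGround M) k S).Within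
      (k * (matroidGround M).card * (3 * N + 3))
      (fun S' => M.Indep (S' : Set U) ∧ S'.card = matroidRank M) := by
  induction k generalizing S with
  | zero =>
    rw [greedyPhase]
    exact within_pure ⟨hS, by omega⟩
  | succ k ih =>
    rw [greedyPhase]
    have hmem : ∀ y, y ∈ ([] ++ (matroidGround M \ S).sort : List U) ↔
        y ∈ matroidGround M \ S := by simp
    have hlen : (matroidGround M \ S).sort.length * (3 * N + 3) +
        k * (matroidGround M).card * (3 * N + 3) ≤
        (k + 1) * (matroidGround M).card * (3 * N + 3) := by
      rw [← add_mul, Finset.length_sort, add_mul k, one_mul, add_comm]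
      gcongr
      exact Finset.sdiff_subset
    have hempty : BestSound M S [] none := by
      intro y hy
      simp at hy
    have hscan := within_bestExtension f c N S (matroidGround M \ S).sort [] none hempty
    refine Within.mono (hscan.bind fun best hbest => ?_) hlen fun _ h => h
    match best, hbest with
    | none, hbest =>
      exfalso
      have h0 : M.Indep ((∅ : Finset U) : Set U) := by simp
      obtain ⟨B, -, hB, hBc⟩ := h0.exists_finset_superset
      obtain ⟨e, heB, heS, he⟩ := hS.augment_finset hB.indep (by omega)
      refine hbest e ?_ (by rwa [Finset.coe_insert])
      rw [hmem, Finset.mem_sdiff]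
      exact ⟨hB.indep.subset_matroidGround heB, heS⟩
    | some (y, u), hbest =>
      obtain ⟨hy, hyi⟩ := hbest
      rw [hmem, Finset.mem_sdiff] at hy
      exact ih (insert y S) hyi (by rw [Finset.card_insert_of_notMem hy.2]; omega)

theorem within_findExchange (f : Finset U → ℝ) (c : ℝ) (N : ℕ) (ε : ℝ) (S : Finset U) (v : ℝ)
    (l : List (U × U)) :
    (findExchange M f c N ε S v l).Within (l.length * (3 * N + 3))
      (fun out => ∀ S' v', out = some (S', v') →
        (∃ p ∈ l, S' = insert p.2 (S.erase p.1)) ∧ M.Indep (S' : Set U)) := by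
  induction l with
  | nil =>
    rw [findExchange]
    exact within_pure (by simp)
  | cons p l ih =>
    obtain ⟨e, x⟩ := p
    have hlen : ((e, x) :: l).length * (3 * N + 3) =
        1 + ((3 * N + 1) + (1 + l.length * (3 * N + 3))) := by
      rw [List.length_cons]
      ring
    have ih' : (findExchange M f c N ε S v l).Within (l.length * (3 * N + 3))
        (fun out => ∀ S' v', out = some (S', v') →
          (∃ p ∈ (e, x) :: l, S' = insert p.2 (S.erase p.1)) ∧ M.Indep (S' : Set U)) := by
      refine ih.mono le_rfl fun out h S' v' ho => ?_
      obtain ⟨⟨p, hp, hS⟩, h⟩ := h S' v' ho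
      exact ⟨⟨p, List.mem_cons_of_mem _ hp, hS⟩, h⟩
    rw [findExchange, hlen]
    refine Within.det_bind (law_queryIndep M _) ?_
    by_cases hy : M.Indep ((insert x (S.erase e) : Finset U) : Set U)
    · rw [if_pos (by simpa using hy)]
      refine Within.bind (within_estimate f c _ N) fun w _ => ?_
      refine Within.det_bind law_step ?_
      split_ifs
      · refine within_pure fun S' v' ho => ?_
        rw [Option.some.injEq, Prod.mk.injEq] at ho
        rw [← ho.1]
        exact ⟨⟨(e, x), by simp, rfl⟩, hy⟩
      · exact ih'
    · rw [if_neg (by simpa using hy)]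
      exact ih'.mono (by omega) fun _ h => h

theorem within_localSearch [Fintype U] (f : Finset U → ℝ) (c : ℝ) (N : ℕ) (ε : ℝ) (k : ℕ)
    (S : Finset U) (v : ℝ) (hS : M.Indep (S : Set U)) (hSc : S.card = matroidRank M) :
    (localSearch M f c N ε (matroidGround M) k S v).Within
      (k * (matroidRank M * (matroidGround M).card) * (3 * N + 3))
      (fun out => ∀ S', out = some S' → M.Indep (S' : Set U)) := by
  induction k generalizing S v with
  | zero =>
    rw [localSearch]
    exact within_pure (by simp)
  | succ k ih =>
    rw [localSearch]
    have hlen : (S.sort.product (matroidGround M \ S).sort).length * (3 * N + 3) +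
        k * (matroidRank M * (matroidGround M).card) * (3 * N + 3) ≤
        (k + 1) * (matroidRank M * (matroidGround M).card) * (3 * N + 3) := by
      rw [← add_mul, add_mul k, one_mul, add_comm, ← hSc]
      gcongr
      exact length_product_sort_le S _
    refine Within.mono (Within.bind (within_findExchange f c N ε S v _) fun ex hex => ?_)
      hlen fun _ h => h
    match ex, hex with
    | none, hex =>
      refine within_pure fun S' ho => ?_
      rw [Option.some.injEq] at ho
      rwa [← ho]
    | some (S', v'), hex =>
      obtain ⟨⟨⟨e, x⟩, hp, rfl⟩, hi⟩ := hex S' v' rfl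
      rw [mem_product_sort, Finset.mem_sdiff] at hp
      exact ih _ v' hi (by rw [card_exchange hp.1 hp.2.2, hSc])

theorem within_nonObliviousSearch [Fintype U] (f : Finset U → ℝ) (c ε α : ℝ) {I N : ℕ}
    (hI : I = numIter (matroidRank M) (epsTwo (matroidRank M) ε))
    (hN : N = numSamples (matroidRank M) (matroidGround M).card c
      (epsTwo (matroidRank M) ε) α I) :
    (nonObliviousSearch M f c ε α).Within
      (((I + 1) * (matroidRank M * (matroidGround M).card) + 1) * (3 * N + 3))
      (fun out => ∀ S', out = some S' → M.Indep (S' : Set U)) := by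
  unfold nonObliviousSearch
  simp only
  rw [← hI, ← hN]
  have h0 : M.Indep ((∅ : Finset U) : Set U) := by simp
  have h1 := within_greedyPhase f c N (matroidRank M) ∅ h0 (by simp)
  refine Within.mono (h1.bind fun S hS => Within.bind (within_estimate f c S N) fun v _ =>
    within_localSearch f c N _ I S v hS.1 hS.2) ?_ fun _ h => h
  have : ((I + 1) * (matroidRank M * (matroidGround M).card) + 1) * (3 * N + 3) =
      matroidRank M * (matroidGround M).card * (3 * N + 3) + ((3 * N + 3) +
        I * (matroidRank M * (matroidGround M).card) * (3 * N + 3)) := by ring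
  rw [this]
  gcongr
  omega

/-- If the whole ground set is independent, then the search always returns it. -/
theorem fails_nonObliviousSearch_of_card_eq [Fintype U] (f : Finset U → ℝ) (c ε α : ℝ)
    (hr : matroidRank M = (matroidGround M).card)
    (hI : numIter (matroidRank M) (epsTwo (matroidRank M) ε) ≠ 0) :
    (nonObliviousSearch M f c ε α).Fails (fun out => out = some (matroidGround M)) 0 := by
  obtain ⟨k, hk⟩ := Nat.exists_eq_succ_of_ne_zero hI
  unfold nonObliviousSearch
  simp only
  rw [hk]
  have h0 : M.Indep ((∅ : Finset U) : Set U) := by simp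
  refine Fails.mono (δ := 0 + (0 + 0))
    (((within_greedyPhase f c _ (matroidRank M) ∅ h0 (by simp)).fails 0).bind fun S hS =>
      ((within_estimate f c S _).fails 0).bind fun v _ => ?_) (fun _ h => h) (by simp)
  -- No exchange exists for the full ground set, so the first iteration returns it whatever was
  -- sampled. This needs `I ≠ 0`, since an exhausted loop reports an error.
  have hSE : S = matroidGround M :=
    Finset.eq_of_subset_of_card_le hS.1.subset_matroidGround (by rw [hS.2, hr])
  rw [localSearch, hSE]
  have hnil : ((matroidGround M).sort.product (matroidGround M \ matroidGround M).sort :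
      List (U × U)) = [] := by
    rw [List.eq_nil_iff_forall_not_mem]
    intro p hp
    rw [mem_product_sort] at hp
    simp at hp
  rw [hnil, findExchange]
  refine Fails.det_bind (law_pure _) ?_
  exact fails_pure (Q := fun out => out = some (matroidGround M)) rfl 0

end Steps

/-! ## The parameters -/

section Parameters

theorem one_le_harmonic {n : ℕ} (hn : 1 ≤ n) : (1 : ℝ) ≤ (harmonic n : ℝ) := by
  have h : (1 : ℚ) ≤ harmonic n := by
    rw [harmonic_eq_sum_Icc]
    have := Finset.single_le_sum (s := Finset.Icc 1 n) (f := fun i : ℕ => (i : ℚ)⁻¹)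
      (fun i _ => by positivity) (Finset.mem_Icc.2 ⟨le_rfl, hn⟩)
    simpa using this
  exact_mod_cast h

theorem harmonic_mono {m n : ℕ} (h : m ≤ n) : (harmonic m : ℝ) ≤ (harmonic n : ℝ) := by
  have : harmonic m ≤ harmonic n := by
    unfold harmonic
    exact Finset.sum_le_sum_of_subset_of_nonneg (by simpa using h) fun i _ _ => by positivity
  exact_mod_cast this

theorem harmonic_le_two_mul_log {m : ℕ} (hm : 1 ≤ m) :
    (harmonic m : ℝ) ≤ 2 * Real.log ((m : ℝ) + 1) := by
  rcases hm.eq_or_lt with rfl | hm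
  · have : (harmonic 1 : ℝ) = 1 := by simp [harmonic]
    rw [this]
    have := Real.log_two_gt_d9
    norm_num at this ⊢
    linarith
  · have h1 := harmonic_le_one_add_log m
    have hm' : (2 : ℝ) ≤ m := by exact_mod_cast hm
    have h2 : Real.log m ≤ Real.log ((m : ℝ) + 1) := Real.log_le_log (by linarith) (by linarith)
    have h3 : 1 ≤ Real.log ((m : ℝ) + 1) := by
      rw [Real.le_log_iff_exp_le (by linarith)]
      have := Real.exp_one_lt_d9
      linarith
    linarith

/-- The slack between `H_n` and `H_r` for `r < n` pays for replacing `n` by `n + 1`. -/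
theorem log_succ_le_harmonic_ratio {r n : ℕ} (hr : 1 ≤ r) (hrn : r < n) :
    Real.log ((n : ℝ) + 1) ≤ ((harmonic n : ℝ) / (harmonic r : ℝ)) ^ 2 * Real.log n := by
  obtain ⟨m, rfl⟩ : ∃ m, n = m + 1 := ⟨n - 1, by omega⟩
  have hm : 1 ≤ m := by omega
  have hr1 := one_le_harmonic hr
  have hm1 := one_le_harmonic hm
  have hrm : (harmonic r : ℝ) ≤ harmonic m := harmonic_mono (by omega)
  have hm0 : (0 : ℝ) < (m : ℝ) + 1 := by positivity
  have hlog : 0 ≤ Real.log ((m : ℝ) + 1) := Real.log_nonneg (by linarith [(Nat.cast_nonneg m : (0:ℝ) ≤ m)])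
  -- With `n = m + 1` and `r ≤ m`, the ratio is at least `H_{m+1} / H_m = 1 + 1 / ((m + 1) H_m)`.
  have h1 : 1 + 2 / (((m : ℝ) + 1) * harmonic m) ≤
      ((harmonic (m + 1) : ℝ) / (harmonic r : ℝ)) ^ 2 := by
    have h2 : 1 + 1 / (((m : ℝ) + 1) * harmonic m) ≤ (harmonic (m + 1) : ℝ) / (harmonic r : ℝ) := by
      calc 1 + 1 / (((m : ℝ) + 1) * harmonic m) = (harmonic (m + 1) : ℝ) / harmonic m := by
            rw [harmonic_succ]
            push_cast
            field_simp
        _ ≤ _ := by gcongr; linarith [harmonic_mono (Nat.le_succ m)]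
    have h3 : 0 ≤ 1 / (((m : ℝ) + 1) * harmonic m) := by positivity
    have h4 : 2 / (((m : ℝ) + 1) * harmonic m) = 2 * (1 / (((m : ℝ) + 1) * harmonic m)) := by ring
    rw [h4]
    calc _ ≤ (1 + 1 / (((m : ℝ) + 1) * harmonic m)) ^ 2 := by nlinarith
      _ ≤ _ := by gcongr
  have h5 : Real.log (((m + 1 : ℕ) : ℝ) + 1) ≤ Real.log ((m : ℝ) + 1) + 1 / ((m : ℝ) + 1) := by
    have h6 : ((m + 1 : ℕ) : ℝ) + 1 = ((m : ℝ) + 1) * (1 + 1 / ((m : ℝ) + 1)) := by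
      push_cast
      field_simp
    rw [h6, Real.log_mul (by positivity) (by positivity)]
    have := Real.log_le_sub_one_of_pos (by positivity : 0 < 1 + 1 / ((m : ℝ) + 1))
    linarith
  -- The increment of the logarithm is covered exactly when `H_m ≤ 2 ln (m + 1)`.
  have h7 : 1 / ((m : ℝ) + 1) ≤
      2 / (((m : ℝ) + 1) * harmonic m) * Real.log ((m : ℝ) + 1) := by
    rw [div_mul_eq_mul_div, div_le_div_iff₀ hm0 (by positivity)]
    have := mul_le_mul_of_nonneg_left (harmonic_le_two_mul_log hm) hm0.le
    linarith
  have h8 := mul_le_mul_of_nonneg_right h1 hlog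
  push_cast at h5 h8 ⊢
  linarith

variable {r n I : ℕ} {c ε α : ℝ}

theorem epsTwo_mul (hr : 1 ≤ r) : 4 * r * epsTwo r ε * (harmonic r : ℝ) = ε := by
  have h1 := one_le_harmonic hr
  have h2 : (1 : ℝ) ≤ r := by exact_mod_cast hr
  unfold epsTwo
  field_simp

theorem epsTwo_pos (hr : 1 ≤ r) (hε : 0 < ε) : 0 < epsTwo r ε := by
  have h1 := one_le_harmonic hr
  have h2 : (1 : ℝ) ≤ r := by exact_mod_cast hr
  unfold epsTwo
  positivity

theorem epsTwo_le (hr : 1 ≤ r) (hε : 0 < ε) : 4 * r * epsTwo r ε ≤ ε := by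
  have h1 := one_le_harmonic hr
  have h2 := epsTwo_pos hr hε
  have h3 := epsTwo_mul (ε := ε) hr
  calc 4 * r * epsTwo r ε ≤ 4 * r * epsTwo r ε * (harmonic r : ℝ) :=
        le_mul_of_one_le_right (by positivity) h1
    _ = ε := h3

/-- Together with Bernoulli's inequality this bounds `(1 + e) ^ I` from below by the factor
separating the cap of the local search from its starting value. -/
theorem le_one_add_numIter_mul {e : ℝ} (he : 0 < e) :
    (1 + e) / (1 - e) * (2 + 3 * r * e) ≤ 1 + numIter r e * e := by
  have h : ((1 + e) / (1 - e) * (2 + 3 * r * e) - 1) * e⁻¹ ≤ numIter r e := Nat.le_ceil _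
  have := mul_le_mul_of_nonneg_right h he.le
  rw [mul_assoc, inv_mul_cancel₀ he.ne', mul_one] at this
  linarith

theorem numIter_pos {e : ℝ} (he : 0 < e) (he1 : e < 1) : 0 < numIter r e := by
  unfold numIter
  rw [Nat.ceil_pos]
  have h1 : 1 ≤ (1 + e) / (1 - e) := by rw [one_le_div (by linarith)]; linarith
  have h2 : 2 ≤ 2 + 3 * r * e := by
    have : 0 ≤ 3 * r * e := by positivity
    linarith
  have h3 : 1 * 2 ≤ (1 + e) / (1 - e) * (2 + 3 * r * e) :=
    mul_le_mul h1 h2 (by norm_num) (by linarith)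
  exact mul_pos (by linarith) (inv_pos.2 he)

theorem density_one_pos (hc : 0 < c) : 0 < density c 1 := by
  have := exp_sub_one_pos hc
  unfold density
  positivity

/-- Only sets of at most `r` elements are sampled, so `τ` involves `H_r` whereas `N` was chosen with
`H_n`. This slack replaces `n` by `n + 1`, the size before contraction, so that no factor `((n + 1)
/ n) ^ α` depending on `α` arises. -/
theorem numSamples_spec {e : ℝ} (hr : 1 ≤ r) (hrn : r < n) (hc : 0 < c) (he : 0 < e)
    (hα : 0 < α) {t : ℝ} (ht : 0 < t) (htr : t ≤ density c 1 * harmonic r) :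
    Real.log (((I : ℝ) + 1) * r * ((n : ℝ) + 1) ^ (1 + α)) ≤
      2 * numSamples r n c e α I * (e / t) ^ 2 := by
  have hr1 := one_le_harmonic hr
  have hn1 := one_le_harmonic (hr.trans hrn.le)
  have hrr : (1 : ℝ) ≤ r := by exact_mod_cast hr
  have hnn : (1 : ℝ) ≤ n := by exact_mod_cast hr.trans hrn.le
  have hD := density_one_pos hc
  have hI : (0 : ℝ) ≤ I := Nat.cast_nonneg I
  set L := Real.log (((I : ℝ) + 1) * r * (n : ℝ) ^ (1 + α)) with hL
  have hceil : 1 / 2 * (density c 1 * ((harmonic n : ℝ) / e)) ^ 2 * L ≤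
      numSamples r n c e α I := by
    have := Nat.le_ceil (1 / 2 * (density c 1 * ((harmonic n : ℝ) / e)) ^ 2 * L)
    unfold numSamples
    unfold density at *
    rwa [mul_one] at *
  set κ := ((harmonic n : ℝ) / (harmonic r : ℝ)) ^ 2 with hκ
  have hLeq : L = Real.log (((I : ℝ) + 1) * r) + (1 + α) * Real.log n := by
    rw [hL, Real.log_mul (by positivity) (by positivity), Real.log_rpow (by linarith)]
  have hlog1 : 0 ≤ Real.log (((I : ℝ) + 1) * r) := Real.log_nonneg (by nlinarith)
  have hlog2 : 0 ≤ Real.log n := Real.log_nonneg hnn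
  have hL0 : 0 ≤ L := by rw [hLeq]; positivity
  have hκ1 : 1 ≤ κ := by
    rw [hκ]
    have : 1 ≤ (harmonic n : ℝ) / (harmonic r : ℝ) := by
      rw [one_le_div (by linarith)]
      exact harmonic_mono hrn.le
    exact one_le_pow₀ this
  have h1 : Real.log (((I : ℝ) + 1) * r * ((n : ℝ) + 1) ^ (1 + α)) ≤ κ * L := by
    rw [Real.log_mul (by positivity) (by positivity), Real.log_rpow (by linarith), hLeq, mul_add]
    have h2 := log_succ_le_harmonic_ratio hr hrn
    have h3 := mul_le_mul_of_nonneg_left h2 (by linarith : 0 ≤ 1 + α)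
    have h4 := mul_le_mul_of_nonneg_right hκ1 hlog1
    rw [← hκ] at h3
    linarith
  refine h1.trans ?_
  have h5 : e / (density c 1 * harmonic r) ≤ e / t := by gcongr
  calc κ * L = 2 * (1 / 2 * (density c 1 * ((harmonic n : ℝ) / e)) ^ 2 * L) *
        (e / (density c 1 * harmonic r)) ^ 2 := by
        rw [hκ]
        field_simp
    _ ≤ _ := by gcongr

theorem numSamples_pos {e : ℝ} (hr : 1 ≤ r) (hn : 1 ≤ n) (hc : 0 < c) (he : 0 < e)
    (hα : 0 < α) (hI : 0 < I) : 0 < numSamples r n c e α I := by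
  have hn1 := one_le_harmonic hn
  have hrr : (1 : ℝ) ≤ r := by exact_mod_cast hr
  have hnn : (1 : ℝ) ≤ n := by exact_mod_cast hn
  have hI' : (1 : ℝ) ≤ I := by exact_mod_cast hI
  have h := exp_sub_one_pos hc
  unfold numSamples
  rw [Nat.ceil_pos]
  have h1 : (1 : ℝ) ≤ (n : ℝ) ^ (1 + α) := Real.one_le_rpow hnn (by linarith)
  have h2 : (1 : ℝ) < ((I : ℝ) + 1) * r := by nlinarith
  have h3 : (1 : ℝ) < ((I : ℝ) + 1) * r * (n : ℝ) ^ (1 + α) := by nlinarith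
  have h4 := Real.log_pos h3
  positivity

end Parameters

/-! ## The guarantee of a single run -/

section Run

variable {U : Type} [Fintype U] [LinearOrder U] {M : Matroid U} {f : Finset U → ℝ} {c ε α : ℝ}

/-- There are at most `r n` estimates in the greedy phase, one for its result and `I r n` in the
local search. Each fails with probability at most `2 / X`. -/
theorem fails_nonObliviousSearch (hm : Monotone f) (h0 : 0 ≤ f ∅) (hd : DimReturns f)
    (hc : 0 < c) (hα : 0 < α) (hε : 0 < ε) (hε1 : ε ≤ 1) (hr : 1 ≤ matroidRank M)
    (hrn : matroidRank M < (matroidGround M).card) :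
    (nonObliviousSearch M f c ε α).Fails
      (fun out => ∃ S, out = some S ∧ LocalOpt M (potential c f) (epsTwo (matroidRank M) ε) S)
      (ENNReal.ofReal (2 * (((matroidGround M).card + 1 : ℕ) : ℝ) ^ (-α))) := by
  set r := matroidRank M with hrdef
  set n := (matroidGround M).card with hndef
  set e := epsTwo r ε with hedef
  set I := numIter r e with hIdef
  set N := numSamples r n c e α I with hNdef
  have hrr : (1 : ℝ) ≤ r := by exact_mod_cast hr
  have he : 0 < e := epsTwo_pos hr hε
  have he4 : e ≤ 1 / 4 := by
    have := epsTwo_le hr hε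
    nlinarith
  have hI : 0 < I := numIter_pos he (by linarith)
  have hN : 0 < N := numSamples_pos hr (hr.trans hrn.le) hc he hα hI
  set X := ((I : ℝ) + 1) * r * ((n : ℝ) + 1) ^ (1 + α) with hX
  have hX0 : 0 < X := by positivity
  have hest : ∀ A : Finset U, A.Nonempty → M.Indep (A : Set U) →
      (estimate f c N A).Fails (Accurate e (potential c f A)) (ENNReal.ofReal (2 / X)) := by
    intro A hA hi
    refine (fails_estimate hc he.le hA hm h0 hd hN).mono (fun _ h => h) ?_
    refine ENNReal.ofReal_le_ofReal ?_
    have htau : tau c A ≤ density c 1 * harmonic r := by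
      refine (tau_le hc A).trans ?_
      have := density_one_pos hc
      have := harmonic_mono hi.card_le_matroidRank
      gcongr
    have := numSamples_spec (I := I) hr hrn hc he hα (tau_pos hc hA) htau
    rw [div_eq_mul_inv 2 X, ← Real.exp_log hX0, ← Real.exp_neg]
    gcongr
  have hg := monotone_potential hm h0 hc
  have hg0 : 0 ≤ potential c f ∅ := (potential_empty c f).ge
  have hgd := dimReturns_potential hm h0 hd hc
  have hgn := potential_nonneg hm h0 hc
  have hempty : M.Indep ((∅ : Finset U) : Set U) := by simp
  unfold nonObliviousSearch
  simp only
  rw [← hrdef, ← hndef, ← hedef, ← hIdef, ← hNdef]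
  have hgreedy := fails_greedyPhase hg hg0 hgd he.le (by linarith) hest r ∅ hempty (by simp [hrdef])
    (greedyInv_empty (potential_empty c f))
  refine Fails.mono (hgreedy.bind fun S hS => (hest S ?_ hS.1).bind fun v hv =>
    fails_localSearch he.le hest
      (fun A hA hAc => hS.2.2.le_mul hg hgd hA (by rw [hAc, hS.2.1])) I S v hS.1 hS.2.1 hv ?_ ?_)
    (fun _ h => h) ?_
  · rw [← Finset.card_pos, hS.2.1]
    exact hr
  · rw [hS.2.1, ← hrdef]
    have h1 := one_add_mul_le_pow (by linarith : -2 ≤ e) I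
    have h2 := le_one_add_numIter_mul (r := r) he
    rw [← hIdef] at h2
    have h3 := hv.le
    have hgS := hgn S
    calc (1 + e) * ((2 + 3 * r * e) * potential c f S) =
          (1 + e) / (1 - e) * (2 + 3 * r * e) * ((1 - e) * potential c f S) := by
          have : 1 - e ≠ 0 := by linarith
          field_simp
      _ ≤ (1 + e) ^ I * v := by
          refine mul_le_mul (by linarith) h3 ?_ (by positivity)
          exact mul_nonneg (by linarith) hgS
  · intro h
    omega
  · have hcount : ((r * n : ℕ) : ℝ≥0∞) * ENNReal.ofReal (2 / X) + (ENNReal.ofReal (2 / X) +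
        ((I * (r * n) : ℕ) : ℝ≥0∞) * ENNReal.ofReal (2 / X)) =
        ENNReal.ofReal ((((I + 1) * (r * n) + 1 : ℕ) : ℝ) * (2 / X)) := by
      rw [ENNReal.ofReal_mul (by positivity), ENNReal.ofReal_natCast]
      push_cast
      ring
    rw [hcount]
    refine ENNReal.ofReal_le_ofReal ?_
    have hn0 : (0 : ℝ) < (n : ℝ) + 1 := by positivity
    rw [hX, Real.rpow_add hn0, Real.rpow_one]
    push_cast
    rw [Real.rpow_neg hn0.le]
    have hp : 0 < ((n : ℝ) + 1) ^ α := Real.rpow_pos_of_pos hn0 α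
    rw [mul_div_assoc', ← div_eq_mul_inv, div_le_div_iff₀ (by positivity) hp]
    -- The single estimate between the two phases is absorbed by passing from `n` to `n + 1`.
    have h1 : ((I : ℝ) + 1) * (r * n) + 1 ≤ ((I : ℝ) + 1) * r * ((n : ℝ) + 1) := by
      have : (0 : ℝ) ≤ I := Nat.cast_nonneg I
      nlinarith
    have h2 := mul_le_mul_of_nonneg_right h1 (by positivity : 0 ≤ 2 * ((n : ℝ) + 1) ^ α)
    linarith

/-- The value of an approximate local optimum. -/
theorem LocalOpt.le_value (hm : Monotone f) (h0 : 0 ≤ f ∅) (hd : DimReturns f)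
    (hcurv : SetFun.HasCurvature (fun B => f B - f ∅) c) (hc : 0 < c) (hc1 : c ≤ 1)
    (hε : 0 < ε) (hε1 : ε ≤ 1 / 2) (hr : 1 ≤ matroidRank M) {S O : Finset U}
    (hS : LocalOpt M (potential c f) (epsTwo (matroidRank M) ε) S) (hO : M.Indep (O : Set U))
    (hOc : O.card = matroidRank M) :
    f O - f ∅ ≤ density c 1 * ((1 + ε) * f S - f ∅) := by
  obtain ⟨hSi, hSc, hopt⟩ := hS
  obtain ⟨π, hinj, himg, hπ⟩ := exists_exchange_bijection hSi hO hSc hOc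
  have hsum := potential_exchange_sum_le_sub hd hcurv hc hc1 π hinj himg fun s hs => (hπ s hs).1
  set e := epsTwo (matroidRank M) ε with hedef
  have hrr : (1 : ℝ) ≤ matroidRank M := by exact_mod_cast hr
  have he : 0 < e := epsTwo_pos hr hε
  have he8 : e ≤ 1 / 8 := by
    have := epsTwo_le hr hε
    nlinarith
  have hgS := potential_nonneg hm h0 hc S
  -- Local optimality gives `(1 + e)² / (1 - e) ≤ 1 + 4e` as the largest possible improvement
  -- factor.
  have hterm : ∀ s ∈ S, -(4 * e * potential c f S) ≤
      potential c f S - potential c f (insert (π s) (S.erase s)) := by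
    intro s hs
    by_cases hsS : π s ∈ S
    · rw [(hπ s hs).1 hsS, Finset.insert_erase hs, sub_self, neg_nonpos]
      positivity
    · have h1 := hopt s hs (π s) hsS (hπ s hs).2
      have h2 : (1 + e) ^ 2 * potential c f S ≤ (1 - e) * ((1 + 4 * e) * potential c f S) := by
        rw [← mul_assoc]
        refine mul_le_mul_of_nonneg_right ?_ hgS
        nlinarith
      have h3 := le_of_mul_le_mul_left (h1.trans h2) (by linarith)
      linarith
  have h1 := Finset.sum_le_sum hterm
  rw [Finset.sum_const, nsmul_eq_mul, hSc] at h1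
  have hfS : 0 ≤ f S := h0.trans (hm (Finset.empty_subset S))
  have h2 : potential c f S ≤ density c 1 * harmonic (matroidRank M) * f S := by
    refine (potential_le_tau_mul hm hc S).trans ?_
    have := tau_le hc S
    rw [hSc] at this
    gcongr
  have h3 := mul_le_mul_of_nonneg_left h2 (by positivity : 0 ≤ 4 * matroidRank M * e)
  have h4 := epsTwo_mul (ε := ε) hr
  rw [← hedef] at h4
  -- The choice `ε₂ = ε / (4 r H_r)` makes the accumulated error of `r` exchanges, with `g S ≤
  -- density c 1 * H_r * f S`, exactly this.
  have h5 : 4 * matroidRank M * e * (density c 1 * harmonic (matroidRank M) * f S) =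
      density c 1 * (ε * f S) := by
    rw [← h4]
    ring
  linarith

end Run

/-! ## The approximation ratio -/

section Rho

variable {c : ℝ}

theorem rho_lt_one (hc : 0 < c) : rho c < 1 := by
  unfold rho
  rw [div_lt_one hc]
  have := Real.add_one_lt_exp (neg_ne_zero.2 hc.ne')
  linarith

theorem half_le_rho (hc : 0 < c) (hc1 : c ≤ 1) : 1 / 2 ≤ rho c := by
  unfold rho
  rw [le_div_iff₀ hc]
  have h1 := Real.add_one_le_exp c
  have h2 : Real.exp (-c) * (c + 1) ≤ 1 := by
    calc Real.exp (-c) * (c + 1) ≤ Real.exp (-c) * Real.exp c := by gcongr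
      _ = 1 := by rw [← Real.exp_add]; simp
  have h3 := Real.exp_pos (-c)
  by_contra h
  push Not at h
  have h4 : 1 - c / 2 < Real.exp (-c) := by linarith
  nlinarith [mul_lt_mul_of_pos_right h4 (by linarith : 0 < c + 1)]

theorem density_one_mul_rho (hc : 0 < c) : density c 1 * rho c = 1 := by
  have h := exp_sub_one_pos hc
  unfold density rho
  rw [mul_one, Real.exp_neg]
  field_simp

end Rho

/-! ## Partial enumeration -/

section Enumeration

variable {U : Type} [LinearOrder U] [Fintype U] {M : Matroid U} {f : Finset U → ℝ} {c ε α : ℝ}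

/-- The best solution found so far is independent and its stored value is correct. -/
def EnumSound (M : Matroid U) (f : Finset U → ℝ) : Option (Finset U × ℝ) → Prop
  | none => True
  | some (T, u) => u = f T ∧ M.Indep (T : Set U)

/-- The best solution found so far has value at least `V`. -/
def EnumGood (M : Matroid U) (f : Finset U → ℝ) (V : ℝ) (best : Option (Finset U × ℝ)) : Prop :=
  EnumSound M f best ∧ ∃ T u, best = some (T, u) ∧ V ≤ u

theorem within_enumLoop {T : ℕ}
    (hrun : ∀ x, M.Indep ({x} : Set U) →
      (nonObliviousSearch (M.contract {x}) (SetFun.contract f x) c ε α).Within T fun _ => True)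
    (xs : List U) (best : Option (Finset U × ℝ)) :
    (enumLoop M f c ε α xs best).Within (xs.length * (T + 3)) fun _ => True := by
  induction xs generalizing best with
  | nil =>
    rw [enumLoop]
    exact within_pure trivial
  | cons x xs ih =>
    have hlen : (x :: xs).length * (T + 3) = 1 + (T + (1 + (1 + xs.length * (T + 3)))) := by
      rw [List.length_cons]
      ring
    rw [enumLoop, hlen]
    refine Within.det_bind (law_queryIndep M _) ?_
    by_cases hx : M.Indep ({x} : Set U)
    · rw [if_pos (by simpa using hx)]
      refine Within.bind (hrun x hx) fun out _ => ?_
      match out with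
      | none => exact (ih best).mono (by omega) fun _ h => h
      | some S =>
        refine Within.det_bind (law_queryValue f _) ?_
        refine Within.det_bind law_step ?_
        match best with
        | none => exact ih _
        | some (T', u) =>
          simp only
          split_ifs
          · exact ih _
          · exact ih _
    · rw [if_neg (by simpa using hx)]
      exact (ih best).mono (by omega) fun _ h => h

/-- One round of the enumeration, given the probability that the run fails to satisfy `Q`. -/
theorem fails_enumLoop_cons {x : U} {xs : List U} {best : Option (Finset U × ℝ)} {δ δ' : ℝ≥0∞}
    {Q : Option (Finset U) → Prop} {R : Option (Finset U × ℝ) → Prop}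
    (hrun : M.Indep ({x} : Set U) →
      (nonObliviousSearch (M.contract {x}) (SetFun.contract f x) c ε α).Fails
        Q δ)
    (hskip : ¬ M.Indep ({x} : Set U) → (enumLoop M f c ε α xs best).Fails R (δ + δ'))
    (hnone : Q none → (enumLoop M f c ε α xs best).Fails R δ')
    (hnew : ∀ S, M.Indep ({x} : Set U) → Q (some S) →
      (∀ T u, best = some (T, u) → u < f (insert x S)) →
      (enumLoop M f c ε α xs (some (insert x S, f (insert x S)))).Fails R δ')
    (hold : ∀ S T u, Q (some S) → best = some (T, u) → f (insert x S) ≤ u →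
      (enumLoop M f c ε α xs (some (T, u))).Fails R δ') :
    (enumLoop M f c ε α (x :: xs) best).Fails R (δ + δ') := by
  rw [enumLoop]
  refine Fails.det_bind (law_queryIndep M _) ?_
  by_cases hx : M.Indep ({x} : Set U)
  · rw [if_pos (by simpa using hx)]
    refine Fails.bind (hrun hx) fun out hout => ?_
    match out, hout with
    | none, hout => exact hnone hout
    | some S, hout =>
      refine Fails.det_bind (law_queryValue f _) ?_
      refine Fails.det_bind law_step ?_
      match best, hnew, hold with
      | none, hnew, _ => exact hnew S hx hout (by simp)
      | some (T, u), hnew, hold =>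
        simp only
        split_ifs with hlt
        · refine hnew S hx hout fun T' u' h => ?_
          rw [Option.some.injEq, Prod.mk.injEq] at h
          rwa [← h.2]
        · exact hold S T u hout rfl (not_lt.1 hlt)
  · rw [if_neg (by simpa using hx)]
    exact hskip hx

/-- In every execution, a run on a contraction returns an independent set. -/
theorem fails_run_indep (f : Finset U → ℝ) (M : Matroid U) (c ε α : ℝ) :
    (nonObliviousSearch M f c ε α).Fails
      (fun out => ∀ S, out = some S → M.Indep (S : Set U)) 0 :=
  (within_nonObliviousSearch f c ε α rfl rfl).fails 0

/-- The stored value never decreases, and a new solution is surely independent, so later runs cannot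
do harm. -/
theorem fails_enumLoop_of_good {V : ℝ} (xs : List U) (best : Option (Finset U × ℝ))
    (h : EnumGood M f V best) : (enumLoop M f c ε α xs best).Fails (EnumGood M f V) 0 := by
  induction xs generalizing best with
  | nil =>
    rw [enumLoop]
    exact fails_pure h 0
  | cons x xs ih =>
    rw [← add_zero (0 : ℝ≥0∞)]
    refine fails_enumLoop_cons (fun _ => fails_run_indep _ _ c ε α) (fun _ => ?_)
      (fun _ => ih best h) (fun S hx hS hlt => ih _ ?_) (fun S T u _ hb _ => ih _ (hb ▸ h))
    · rw [add_zero]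
      exact ih best h
    · obtain ⟨T, u, hb, hV⟩ := h.2
      exact ⟨⟨rfl, ((contract_indep_iff_insert hx).1 (hS S rfl)).2⟩, _, _, rfl,
        hV.trans (hlt T u hb).le⟩

/-- Only the run for `x₀` costs probability; before and after it, nothing but the sure independence
of outputs is used. The enumeration thus adds no factor `n` to the failure probability. -/
theorem fails_enumLoop {V : ℝ} {δ : ℝ≥0∞} {x₀ : U} (hx₀ : M.Indep ({x₀} : Set U))
    (hrun : (nonObliviousSearch (M.contract {x₀}) (SetFun.contract f x₀) c ε α).Fails
      (fun out => ∃ S : Finset U, out = some S ∧ (M.contract {x₀}).Indep (S : Set U) ∧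
        V ≤ f (insert x₀ S)) δ)
    (xs : List U) (hmem : x₀ ∈ xs) (best : Option (Finset U × ℝ)) (h : EnumSound M f best) :
    (enumLoop M f c ε α xs best).Fails (EnumGood M f V) δ := by
  induction xs generalizing best with
  | nil => simp at hmem
  | cons x xs ih =>
    by_cases hxx : x = x₀
    · subst hxx
      rw [← add_zero δ]
      refine fails_enumLoop_cons (fun _ => hrun) (fun hx => absurd hx₀ hx)
        (fun ⟨S, hS, _⟩ => by simp at hS) (fun S _ hS _ => ?_) (fun S T u hS hb hle => ?_)
      · obtain ⟨S', hS', hi, hV⟩ := hS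
        rw [Option.some.injEq] at hS'
        subst hS'
        exact fails_enumLoop_of_good xs _
          ⟨⟨rfl, ((contract_indep_iff_insert hx₀).1 hi).2⟩, _, _, rfl, hV⟩
      · obtain ⟨S', hS', hi, hV⟩ := hS
        rw [Option.some.injEq] at hS'
        subst hS'
        exact fails_enumLoop_of_good xs _ ⟨hb ▸ h, _, _, rfl, hV.trans hle⟩
    · have hmem' : x₀ ∈ xs := by
        rcases List.mem_cons.1 hmem with h | h
        · exact absurd h.symm hxx
        · exact h
      rw [← zero_add δ]
      refine fails_enumLoop_cons (fun _ => fails_run_indep _ _ c ε α) (fun _ => ?_)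
        (fun _ => ih hmem' best h) (fun S hx hS _ => ih hmem' _ ?_)
        (fun S T u _ hb _ => ih hmem' _ (hb ▸ h))
      · rw [zero_add]
        exact ih hmem' best h
      · exact ⟨rfl, ((contract_indep_iff_insert hx).1 (hS S rfl)).2⟩

omit [Fintype U] in
theorem monotone_contract (hm : Monotone f) (x : U) : Monotone (SetFun.contract f x) :=
  fun _ _ h => hm (Finset.insert_subset_insert x h)

omit [Fintype U] in
theorem dimReturns_contract (hd : DimReturns f) (x : U) : DimReturns (SetFun.contract f x) := by
  intro A B y hAB
  unfold SetFun.contract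
  rw [Finset.insert_comm x y, Finset.insert_comm x y]
  exact hd _ _ y (Finset.insert_subset_insert x hAB)

-- Contraction only decreases the singleton values on the left side, while marginals of `f / x` are
-- marginals of `f` at larger sets. The element `x` itself remains in the type, with value and
-- marginals `0`.
omit [Fintype U] in
theorem hasCurvature_contract_sub (hd : DimReturns f) (h0 : f ∅ = 0)
    (hcurv : SetFun.HasCurvature f c) (hc1 : c ≤ 1) (x : U) :
    SetFun.HasCurvature (fun B => SetFun.contract f x B - SetFun.contract f x ∅) c := by
  intro A y hy
  unfold SetFun.contract
  by_cases hxy : y = x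
  · subst hxy
    simp
  · have h1 := hcurv (insert x A) y (by simp [hxy, hy])
    have h2 := hd ∅ {x} y (Finset.empty_subset _)
    change (1 - c) * (f (insert x {y}) - f (insert x ∅)) ≤
      f (insert x (insert y A)) - f (insert x ∅) - (f (insert x A) - f (insert x ∅))
    rw [Finset.insert_comm x y, Finset.pair_comm x y]
    simp only [insert_empty_eq, h0, sub_zero] at h2 ⊢
    have h3 := mul_le_mul_of_nonneg_left h2 (sub_nonneg.2 hc1)
    linarith

/-- The run for a most valuable element of an optimal base almost attains the ratio `ρ(c)`. -/
theorem fails_best_run (hM : M.E = Set.univ) (hr : 2 ≤ matroidRank M) (h0 : f ∅ = 0)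
    (hm : Monotone f) (hd : DimReturns f) (hcurv : SetFun.HasCurvature f c) (hc : 0 < c)
    (hc1 : c ≤ 1) (hα : 0 < α) {O : Finset U} (hO : M.Indep (O : Set U))
    (hOc : O.card = matroidRank M) {x : U} (hxO : x ∈ O) (hmax : ∀ y ∈ O, f {y} ≤ f {x}) :
    (nonObliviousSearch (M.contract {x}) (SetFun.contract f x) c
      ((1 - rho c) / matroidRank M) α).Fails
      (fun out => ∃ S : Finset U, out = some S ∧ (M.contract {x}).Indep (S : Set U) ∧
        rho c * f O ≤ f (insert x S)) (ENNReal.ofReal (2 * (Fintype.card U : ℝ) ^ (-α))) := by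
  have hρ1 := rho_lt_one hc
  have hρ2 := half_le_rho hc hc1
  have hrr : (2 : ℝ) ≤ matroidRank M := by exact_mod_cast hr
  set ε := (1 - rho c) / matroidRank M with hε
  have hεpos : 0 < ε := div_pos (by linarith) (by linarith)
  have hε2 : ε ≤ 1 / 2 := by
    rw [hε, div_le_iff₀ (by linarith)]
    linarith
  have hnn : ∀ A, 0 ≤ f A := fun A => h0.symm.le.trans (hm (Finset.empty_subset A))
  have hx : M.Indep ({x} : Set U) := hO.subset (by simpa using hxO)
  have hrank := matroidRank_contract hx
  have hcard := card_matroidGround_contract (M := M) hM x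
  have hr1 : 1 ≤ matroidRank (M.contract {x}) := by omega
  have hm' := monotone_contract hm x
  have hd' := dimReturns_contract hd x
  have h0' : 0 ≤ SetFun.contract f x ∅ := hnn _
  have hempty : (M.contract {x}).Indep ((∅ : Finset U) : Set U) := by simp
  obtain ⟨B, -, hB, hBc⟩ := hempty.exists_finset_superset
  have hBE := hB.indep.subset_matroidGround
  -- If the contracted ground set is independent, the harmonic slack used for the sample size is
  -- absent, but the search then surely returns everything.
  rcases (Finset.card_le_card hBE).eq_or_lt with heq | hlt
  · have hI : numIter (matroidRank (M.contract {x})) (epsTwo (matroidRank (M.contract {x})) ε) ≠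
        0 := by
      refine (numIter_pos (epsTwo_pos hr1 hεpos) ?_).ne'
      have h1 := epsTwo_le hr1 hεpos
      have h2 : (1 : ℝ) ≤ matroidRank (M.contract {x}) := by exact_mod_cast hr1
      have h3 := epsTwo_pos hr1 hεpos
      nlinarith
    refine (fails_nonObliviousSearch_of_card_eq (SetFun.contract f x) c ε α (by omega) hI).mono
      (fun out hout => ⟨_, hout, ?_, ?_⟩) zero_le
    · rw [← Finset.eq_of_subset_of_card_le hBE heq.ge]
      exact hB.indep
    · have h1 : O ⊆ insert x (matroidGround (M.contract {x})) := by
        intro y _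
        rw [Finset.mem_insert, mem_matroidGround, Matroid.contract_ground, hM]
        by_cases h : y = x
        · exact Or.inl h
        · exact Or.inr ⟨trivial, h⟩
      calc rho c * f O ≤ 1 * f O := mul_le_mul_of_nonneg_right hρ1.le (hnn O)
        _ ≤ _ := by rw [one_mul]; exact hm h1
  · refine (fails_nonObliviousSearch hm' h0' hd' hc hα hεpos (by linarith) hr1
      (by omega)).mono (fun out hout => ?_) (by rw [hcard])
    obtain ⟨S, rfl, hS⟩ := hout
    refine ⟨S, rfl, hS.1, ?_⟩
    have hO' : (M.contract {x}).Indep ((O.erase x : Finset U) : Set U) := by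
      rw [contract_indep_iff_insert hx, Finset.insert_erase hxO]
      exact ⟨Finset.notMem_erase x O, hO⟩
    have hval := hS.le_value hm' h0' hd' (hasCurvature_contract_sub hd h0 hcurv hc1 x) hc hc1
      hεpos hε2 hr1 hO' (by rw [Finset.card_erase_of_mem hxO]; omega)
    unfold SetFun.contract at hval
    rw [Finset.insert_erase hxO, insert_empty_eq] at hval
    have h1 := mul_le_mul_of_nonneg_left hval (by linarith : 0 ≤ rho c)
    rw [← mul_assoc, mul_comm (rho c) (density c 1), density_one_mul_rho hc, one_mul] at h1
    have h2 : f O ≤ matroidRank M * f {x} := by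
      refine (hd.le_sum_singleton h0 O).trans ?_
      rw [← hOc, ← nsmul_eq_mul]
      exact Finset.sum_le_card_nsmul O _ _ hmax
    -- After multiplication by `ρ`, `h1` reads `ρ (f O - f {x}) ≤ (1 + ε) f(S + x) - f {x}`. The
    -- surplus `(1 - ρ) f {x}` covers `ε f O`, because `x` is a most valuable element of the `r` in
    -- `O`.
    have h3 : ε * f O ≤ (1 - rho c) * f {x} := by
      calc ε * f O ≤ ε * (matroidRank M * f {x}) := by gcongr
        _ = (1 - rho c) * f {x} := by
          rw [hε]
          field_simp
    have h4 : (1 + ε) * (rho c * f O) ≤ (1 + ε) * f (insert x S) := by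
      have : ε * (rho c * f O) ≤ ε * (1 * f O) :=
        mul_le_mul_of_nonneg_left (mul_le_mul_of_nonneg_right hρ1.le (hnn O)) hεpos.le
      linarith
    exact le_of_mul_le_mul_left h4 (by linarith)

theorem fails_partialEnumeration (hM : M.E = Set.univ) (hr : 2 ≤ matroidRank M) (h0 : f ∅ = 0)
    (hm : Monotone f) (hd : DimReturns f) (hcurv : SetFun.HasCurvature f c) (hc : 0 < c)
    (hc1 : c ≤ 1) (hα : 0 < α) :
    (partialEnumeration M f c α).Fails (IsApproxSolution M f (rho c))
      (ENNReal.ofReal (2 * (Fintype.card U : ℝ) ^ (-α))) := by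
  classical
  have hempty : M.Indep ((∅ : Finset U) : Set U) := by simp
  obtain ⟨A, hA, hAmax⟩ := Finset.exists_max_image
    (Finset.univ.filter fun A : Finset U => M.Indep (A : Set U)) f ⟨∅, by simp⟩
  -- By monotonicity an optimal set may be enlarged to a base, as the exchange argument requires.
  obtain ⟨O, hAO, hO, hOc⟩ := Matroid.Indep.exists_finset_superset (Finset.mem_filter.1 hA).2
  have hopt : ∀ T : Finset U, M.Indep (T : Set U) → f T ≤ f O := fun T hT =>
    (hAmax T (by simpa using hT)).trans (hm hAO)
  obtain ⟨x, hxO, hmax⟩ := Finset.exists_max_image O (fun y => f {y})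
    (Finset.card_pos.1 (by omega))
  have hx : M.Indep ({x} : Set U) := hO.indep.subset (by simpa using hxO)
  have hrun := fails_best_run hM hr h0 hm hd hcurv hc hc1 hα hO.indep hOc hxO hmax
  have hmem : x ∈ (matroidGround M).sort := by
    rw [Finset.mem_sort, mem_matroidGround, hM]
    trivial
  have hloop := fails_enumLoop hx hrun (matroidGround M).sort hmem none trivial
  unfold partialEnumeration
  rw [← add_zero (ENNReal.ofReal _)]
  refine hloop.bind fun best hbest => ?_
  obtain ⟨hs, T, u, rfl, hV⟩ := hbest
  have hu : u = f T := hs.1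
  refine fails_pure ⟨T, rfl, hs.2, fun T' hT' => (le_trans ?_ hV).trans hu.le⟩ 0
  exact mul_le_mul_of_nonneg_left (hopt T' hT') (by linarith [half_le_rho hc hc1])

end Enumeration

/-! ## The running time -/

section RunningTime

variable {r n I : ℕ} {c q e L a α : ℝ}

theorem one_le_log_div (hn : 2 ≤ n) (hq : 0 < q) (hq2 : q ≤ 1 / 2) :
    1 ≤ Real.log ((n : ℝ) / q) := by
  have hn' : (2 : ℝ) ≤ n := by exact_mod_cast hn
  rw [Real.le_log_iff_exp_le (by positivity), le_div_iff₀ hq]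
  have := Real.exp_one_lt_d9
  nlinarith [Real.exp_pos 1]

theorem log_le_log_div {m : ℕ} (hm : 1 ≤ m) (hmn : m ≤ n) (hq : 0 < q) (hq2 : q ≤ 1 / 2) :
    Real.log m ≤ Real.log ((n : ℝ) / q) := by
  have hm' : (1 : ℝ) ≤ m := by exact_mod_cast hm
  have hmn' : (m : ℝ) ≤ n := by exact_mod_cast hmn
  refine Real.log_le_log (by linarith) ?_
  rw [le_div_iff₀ hq]
  nlinarith

theorem harmonic_le_log_div {m : ℕ} (hm : 1 ≤ m) (hmn : m ≤ n) (hn : 2 ≤ n) (hq : 0 < q)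
    (hq2 : q ≤ 1 / 2) : (harmonic m : ℝ) ≤ 2 * Real.log ((n : ℝ) / q) := by
  have := harmonic_le_one_add_log m
  have := log_le_log_div hm hmn hq hq2
  have := one_le_log_div hn hq hq2
  linarith

theorem inv_epsTwo_le (hr : 1 ≤ r) (hq : 0 < q) (hH : (harmonic r : ℝ) ≤ 2 * L) :
    (epsTwo r (q / ((r : ℝ) + 1)))⁻¹ ≤ 8 * ((r : ℝ) + 1) ^ 2 * L / q := by
  have h1 := one_le_harmonic hr
  have hr0 : (0 : ℝ) < r := by exact_mod_cast hr
  unfold epsTwo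
  rw [inv_div, div_div_eq_mul_div]
  have h2 : 4 * (r : ℝ) * harmonic r * ((r : ℝ) + 1) ≤
      4 * ((r : ℝ) + 1) * (2 * L) * ((r : ℝ) + 1) := by
    gcongr
    linarith
  refine (div_le_div_of_nonneg_right h2 hq.le).trans (le_of_eq ?_)
  ring

theorem numIter_add_one_le (he : 0 < e) (hre : 4 * r * e ≤ 1 / 4) (he1 : e ≤ 1 / 16) {E : ℝ}
    (hE : e⁻¹ ≤ E) : (numIter r e : ℝ) + 1 ≤ 3 * E + 2 := by
  have h1 : (1 + e) / (1 - e) ≤ 17 / 15 := by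
    rw [div_le_div_iff₀ (by linarith) (by norm_num)]
    linarith
  have h2 : (1 + e) / (1 - e) * (2 + 3 * r * e) ≤ 17 / 15 * (2 + 3 / 16) := by
    have h0 : 0 ≤ 3 * r * e := by positivity
    refine mul_le_mul h1 (by linarith) (by linarith) (by norm_num)
  have h3 : 0 ≤ ((1 + e) / (1 - e) * (2 + 3 * r * e) - 1) := by
    have h4 : 1 ≤ (1 + e) / (1 - e) := by rw [one_le_div (by linarith)]; linarith
    have h0 : 0 ≤ 3 * r * e := by positivity
    nlinarith
  have h4 := Nat.ceil_lt_add_one (mul_nonneg h3 (inv_pos.2 he).le)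
  have h5 : ((1 + e) / (1 - e) * (2 + 3 * r * e) - 1) * e⁻¹ ≤ 3 * E :=
    mul_le_mul (by linarith) hE (inv_pos.2 he).le (by norm_num)
  unfold numIter
  linarith

theorem numSamples_le {E X : ℝ} (hn : 1 ≤ n) (he : 0 < e) (hc : 0 < c) (hD : density c 1 ≤ 2)
    (hH : (harmonic n : ℝ) ≤ 2 * L) (hE : e⁻¹ ≤ E) (hL : 0 ≤ L)
    (hX : Real.log (((I : ℝ) + 1) * r * (n : ℝ) ^ (1 + α)) ≤ X) (hX0 : 0 ≤ X) :
    (numSamples r n c e α I : ℝ) ≤ 8 * (L * E) ^ 2 * X + 1 := by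
  have h1 := one_le_harmonic hn
  have h2 := density_one_pos hc
  have hDeq : c * Real.exp c / (Real.exp c - 1) = density c 1 := by
    unfold density
    rw [mul_one]
  have h3 : density c 1 * ((harmonic n : ℝ) / e) ≤ 2 * (2 * L * E) := by
    rw [div_eq_mul_inv]
    gcongr
  have h4 : 1 / 2 * (density c 1 * ((harmonic n : ℝ) / e)) ^ 2 *
      Real.log (((I : ℝ) + 1) * r * (n : ℝ) ^ (1 + α)) ≤ 8 * (L * E) ^ 2 * X := by
    calc _ ≤ 1 / 2 * (density c 1 * ((harmonic n : ℝ) / e)) ^ 2 * X := by gcongr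
      _ ≤ 1 / 2 * (2 * (2 * L * E)) ^ 2 * X := by gcongr
      _ = _ := by ring
  have h5 : 0 ≤ 8 * (L * E) ^ 2 * X := by positivity
  unfold numSamples
  rw [hDeq]
  refine (Nat.cast_le.2 (Nat.ceil_mono h4)).trans ?_
  exact (Nat.ceil_lt_add_one h5).le

/-- The bound for the number of steps of the whole enumeration. -/
theorem enumeration_steps_le (hr : 1 ≤ r) (hrn : r ≤ n) (hc : 0 < c) (hD : density c 1 ≤ 2)
    (hq : 0 < q) (hq2 : q ≤ 1 / 2) (hα : 0 < α)
    (he : e = epsTwo r (q / ((r + 1 : ℕ) : ℝ))) (hI : I = numIter r e) :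
    (((n + 1) * ((((I + 1) * (r * n) + 1) * (3 * numSamples r n c e α I + 3)) + 3) : ℕ) : ℝ) ≤
      1278186 * (((r + 1 : ℕ) : ℝ) ^ 7 * ((n + 1 : ℕ) : ℝ) ^ 2 * max α 1) / q ^ 3 *
        Real.log (((n + 1 : ℕ) : ℝ) / q) ^ 6 := by
  set L := Real.log (((n + 1 : ℕ) : ℝ) / q) with hLdef
  set a := max α 1 with ha
  have hn : 1 ≤ n := hr.trans hrn
  have hL1 : 1 ≤ L := one_le_log_div (by omega) hq hq2
  have hHr : (harmonic r : ℝ) ≤ 2 * L := harmonic_le_log_div hr (by omega) (by omega) hq hq2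
  have hHn : (harmonic n : ℝ) ≤ 2 * L := harmonic_le_log_div hn (by omega) (by omega) hq hq2
  have hr1 : (1 : ℝ) ≤ r := by exact_mod_cast hr
  have hn1 : (1 : ℝ) ≤ n := by exact_mod_cast hn
  have ha1 : 1 ≤ a := le_max_right _ _
  have haα : α ≤ a := le_max_left _ _
  push_cast at he ⊢
  set R : ℝ := (r : ℝ) + 1 with hR
  have hR2 : 2 ≤ R := by linarith
  set E : ℝ := 8 * R ^ 2 * L / q with hEdef
  have hEinv : e⁻¹ ≤ E := by
    rw [he]
    exact inv_epsTwo_le hr hq hHr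
  have hεpos : 0 < q / R := by positivity
  have hε4 : q / R ≤ 1 / 4 := by
    rw [div_le_iff₀ (by linarith)]
    linarith
  have hepos : 0 < e := he ▸ epsTwo_pos hr hεpos
  have hre : 4 * r * e ≤ 1 / 4 := he ▸ (epsTwo_le hr hεpos).trans hε4
  have he16 : e ≤ 1 / 16 := by nlinarith
  have hW : 1 ≤ R ^ 2 * L / q := by
    rw [le_div_iff₀ hq]
    nlinarith [mul_le_mul hR2 hL1 (by norm_num) (by linarith : 0 ≤ R)]
  -- `3E` is `24` times the bracket, and the remaining `2` is absorbed since the bracket is at least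
  -- `1`.
  have hI1 : (I : ℝ) + 1 ≤ 26 * (R ^ 2 * L / q) := by
    have h1 := numIter_add_one_le hepos hre he16 hEinv
    rw [← hI] at h1
    have h2 : 3 * E = 24 * (R ^ 2 * L / q) := by rw [hEdef]; ring
    linarith
  have hI0 : (0 : ℝ) ≤ I := Nat.cast_nonneg I
  -- The count is `25 + 4 + 1 + 2 = 32`: `ln 26`, the rest of `ln (I + 1)`, `ln r`, and `(1 + α) ln
  -- n ≤ 2 a L`.
  have hX : Real.log (((I : ℝ) + 1) * r * (n : ℝ) ^ (1 + α)) ≤ 32 * a * L := by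
    rw [Real.log_mul (by positivity) (by positivity), Real.log_mul (by positivity) (by positivity),
      Real.log_rpow (by linarith)]
    have h1 : Real.log ((I : ℝ) + 1) ≤ Real.log (26 * (R ^ 2 * L / q)) :=
      Real.log_le_log (by positivity) hI1
    have h2 : Real.log (26 * (R ^ 2 * L / q)) = Real.log 26 + (2 * Real.log R + Real.log L) +
        Real.log q⁻¹ := by
      rw [div_eq_mul_inv, ← mul_assoc, Real.log_mul (by positivity) (by positivity),
        Real.log_mul (by positivity) (by positivity), Real.log_mul (by positivity) (by positivity),
        Real.log_pow]
      push_cast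
      ring
    have h3 : Real.log 26 ≤ 25 := by
      have := Real.log_le_sub_one_of_pos (by norm_num : (0 : ℝ) < 26)
      linarith
    have h4 : Real.log R ≤ L := by
      have : Real.log ((r + 1 : ℕ) : ℝ) ≤ L := log_le_log_div (by omega) (by omega) hq hq2
      rwa [Nat.cast_add_one, ← hR] at this
    have h5 : Real.log L ≤ L := by
      have := Real.log_le_sub_one_of_pos (by linarith : 0 < L)
      linarith
    have h6 : Real.log q⁻¹ ≤ L := by
      rw [hLdef]
      refine Real.log_le_log (by positivity) ?_
      rw [inv_eq_one_div]
      gcongr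
      push_cast
      linarith
    have h7 : Real.log r ≤ L := log_le_log_div hr (by omega) hq hq2
    have h8 : Real.log n ≤ L := log_le_log_div hn (by omega) hq hq2
    have h9 : (1 + α) * Real.log n ≤ (2 * a) * L :=
      mul_le_mul (by linarith) h8 (Real.log_nonneg hn1) (by linarith)
    have h10 : 1 * L ≤ a * L := mul_le_mul_of_nonneg_right ha1 (by linarith)
    linarith
  have hN := numSamples_le (c := c) (r := r) (I := I) (α := α) hn hepos hc hD hHn hEinv
    (by linarith) hX (by positivity)
  set N := numSamples r n c e α I with hNdef
  set Z : ℝ := R ^ 4 * L ^ 5 * a / q ^ 2 with hZ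
  have hZ1 : 1 ≤ Z := by
    rw [hZ, le_div_iff₀ (by positivity), one_mul]
    have h1 : q ^ 2 ≤ 1 := pow_le_one₀ hq.le (by linarith)
    have h2 : 1 ≤ R ^ 4 := one_le_pow₀ (by linarith)
    have h3 : 1 ≤ L ^ 5 := one_le_pow₀ hL1
    have h4 := one_le_mul_of_one_le_of_one_le (one_le_mul_of_one_le_of_one_le h2 h3) ha1
    linarith
  -- `49161 = 3 (16384 + 1) + 6`, where the `1` comes from rounding `N` up.
  have hN' : 3 * (N : ℝ) + 6 ≤ 49161 * Z := by
    have h1 : 8 * (L * E) ^ 2 * (32 * a * L) = 16384 * Z := by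
      rw [hEdef, hZ]
      field_simp
      ring
    linarith
  have hN0 : (0 : ℝ) ≤ N := Nat.cast_nonneg N
  have hRn : ((I : ℝ) + 1) * (r * n) + 1 ≤ ((I : ℝ) + 1) * (R * (n + 1)) := by
    rw [hR]
    nlinarith
  have hone : 1 ≤ ((I : ℝ) + 1) * (R * (n + 1)) :=
    one_le_mul_of_one_le_of_one_le (by linarith)
      (one_le_mul_of_one_le_of_one_le (by linarith) (by linarith))
  calc ((n : ℝ) + 1) * ((((I : ℝ) + 1) * (r * n) + 1) * (3 * N + 3) + 3)
      ≤ ((n : ℝ) + 1) * (((I : ℝ) + 1) * (R * (n + 1)) * (3 * N + 6)) := by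
        gcongr
        have := mul_le_mul_of_nonneg_right hRn (by linarith : 0 ≤ 3 * (N : ℝ) + 3)
        linarith
    _ ≤ ((n : ℝ) + 1) * (26 * (R ^ 2 * L / q) * (R * (n + 1)) * (49161 * Z)) := by
        gcongr
    _ = _ := by
        rw [hZ]
        field_simp
        ring

end RunningTime

/-! ### The theorem -/

theorem theorem7p2 :
    ∃ (C : ℝ) (k : ℕ), 0 < C ∧
      ∀ (U : Type) [Fintype U] [LinearOrder U] (M : Matroid U) (f : Finset U → ℝ) (c α : ℝ),
        M.E = Set.univ → 2 ≤ matroidRank M →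
        SetFun.Normalized f → Monotone f → SetFun.Submodular f → SetFun.HasCurvature f c →
        0 < c → c ≤ 1 → 0 < α →
        (∀ ω ∈ (partialEnumeration M f c α).law.support,
          (ω.2 : ℝ) ≤
            C * ((matroidRank M : ℝ) ^ 7 * (Fintype.card U : ℝ) ^ 2 * max α 1)
              / (1 - rho c) ^ 3
              * Real.log ((Fintype.card U : ℝ) / (1 - rho c)) ^ k) ∧
        1 - C * (Fintype.card U : ℝ) ^ (-α) ≤
          ((partialEnumeration M f c α).law.toOuterMeasure
            {ω | IsApproxSolution M f (rho c) ω.1}).toReal := by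
  -- `1278186 = 26 · 49161` from the bounds on `I + 1` and `3N + 6`. The logarithm has power `6`:
  -- one from `I` and five from `N`. For the probability `C = 2` would do.
  refine ⟨1278186, 6, by norm_num, ?_⟩
  intro U _ _ M f c α hM hr h0 hm hs hcurv hc hc1 hα
  have hd := hs.dimReturns hm
  have hpow : (0 : ℝ) ≤ (Fintype.card U : ℝ) ^ (-α) := Real.rpow_nonneg (Nat.cast_nonneg _) _
  refine ⟨fun ω hω => ?_, ?_⟩
  · have hρ1 := rho_lt_one hc
    have hρ2 := half_le_rho hc hc1
    -- This is where `c ≤ 1` makes the constant absolute: `ρ(c) ≥ 1/2` and `density c 1 = 1 / ρ(c)`.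
    have hD : density c 1 ≤ 2 := by
      have h1 := density_one_mul_rho hc
      have h2 := density_one_pos hc
      nlinarith
    obtain ⟨r, hr'⟩ : ∃ r, matroidRank M = r + 1 := ⟨matroidRank M - 1, by omega⟩
    have hempty : M.Indep ((∅ : Finset U) : Set U) := by simp
    obtain ⟨B, -, -, hBc⟩ := hempty.exists_finset_superset
    have hcard := Finset.card_le_univ B
    obtain ⟨n, hn⟩ : ∃ n, Fintype.card U = n + 1 := ⟨Fintype.card U - 1, by omega⟩
    have hground : (matroidGround M).sort.length = n + 1 := by
      have : matroidGround M = Finset.univ := by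
        ext y
        simp [mem_matroidGround, hM]
      rw [Finset.length_sort, this, Finset.card_univ, hn]
    set e := epsTwo r ((1 - rho c) / ((r + 1 : ℕ) : ℝ)) with he
    have hrun : ∀ x, M.Indep ({x} : Set U) →
        (nonObliviousSearch (M.contract {x}) (SetFun.contract f x) c
          ((1 - rho c) / matroidRank M) α).Within
            (((numIter r e + 1) * (r * n) + 1) * (3 * numSamples r n c e α (numIter r e) + 3))
            fun _ => True := by
      intro x hx
      have h1 := matroidRank_contract hx
      have h2 := card_matroidGround_contract (M := M) hM x
      have h3 : matroidRank (M.contract {x}) = r := by omega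
      have h4 : (matroidGround (M.contract {x})).card = n := by omega
      have h5 := within_nonObliviousSearch (M := M.contract {x}) (SetFun.contract f x) c
        ((1 - rho c) / matroidRank M) α rfl rfl
      rw [h3, h4, hr', ← he] at h5
      rw [hr']
      exact h5.mono le_rfl fun _ _ => trivial
    have hloop := within_enumLoop hrun (matroidGround M).sort none
    have htotal := hloop.bind (T := 0) (R := fun _ => True)
      (q := fun best => pure (best.map Prod.fst)) fun _ _ => within_pure trivial
    have hsteps := (htotal ω hω).1
    rw [hground, add_zero] at hsteps
    rw [hr', hn]
    exact (Nat.cast_le.2 hsteps).trans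
      (enumeration_steps_le (by omega) (by omega) hc hD (by linarith) (by linarith) hα he rfl)
  · refine le_trans ?_ (toOuterMeasure_of_fails (by positivity)
      (fails_partialEnumeration hM hr h0 hm hd hcurv hc hc1 hα))
    linarith
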